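/- Let $\mathbb K\in\{\mathbb R,\mathbb C\}$, let $B,\bar B$ be Banach spaces over $\mathbb K$, and let $G:B\to\bar B$ be analytic near $0$ with $G[0]=0$. Solution sets. For $z_1,\dots,z_m\in B$ let $T^m[z_1,\dots,z_m]\in\bar B$ be the $m$-th derivative at $\varepsilon=0$ of $\varepsilon\mapsto G[\varepsilon z_1+\dots+\frac1{m!}\varepsilon^m z_m]$. Let $X_n\subset B^n$ be the set of solutions of $T^1[z_1]=0,\dots,T^n[z_1,\dots,z_n]=0$, and $X_\infty$ the set of sequences $(z_i)_{i\ge1}$ satisfying $T^m=0$ for all $m\ge 1$. Fix $[\bar z_1,\dots,\bar z_k]\in B^k$, $k\ge1$. Let $\bar X_n$ ($n\ge k$) and $\bar X_\infty$ be the elements of $X_n$ and $X_\infty$ with leading coefficients $[\bar z_1,\dots,\bar z_k]$, and let $\pi_l$ denote truncation to the first $l$ coefficients. Operators. Let $L_t\in L[B,\bar B]$ be the coefficient of $\varepsilon^t$ in $G'[\varepsilon\bar z_1+\dots+\frac1{k!}\varepsilon^k\bar z_k]$. Put $N_0=B$, $R_0^c=\bar B$. Recursively for $i=0,\dots,k$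 define $S_{i+1}:N_i\to R_i^c$ by $$S_{i+1}n=\frac{(2i)!}{i!}\,P_{R_i^c}\sum_{t=0}^{i}L_t v_{i-t},$$ where $v_0=n$ and $v_1,v_2,\dots\in B$ are chosen such that $\sum_{t\le s}L_tv_{s-t}=0$ for all $0\le s<i$ (the value does not depend on this choice), and $P_{R_i^c}$ is the projection along $\bar B=R_1\oplus\dots\oplus R_i\oplus R_i^c$; so $S_1=G'[0]$ and $S_2=P_{R_1^c}\circ 2G''[0]\bar z_1|_{N_1}$. Let $N_{i+1}$ and $R_{i+1}$ be the null space and the range of $S_{i+1}$. It is assumed that there are direct sums of closed subspaces $N_i=N_{i+1}^c\oplus N_{i+1}$ and $R_i^c=R_{i+1}\oplus R_{i+1}^c$ for $i=0,\dots,k$, and these are fixed. Assume that $[\bar z_1,\dots,\bar z_k]$ is regular of degree $k$, i.e. $\bar X_{2k}\neq\emptyset$ and the sum operator $[S_1\cdots S_{k+1}]:N_0\times\dots\times N_k\to\bar B$, $(n_0,\dots,n_k)\mapsto S_1n_0+\dots+S_{k+1}n_k$, is surjective, and that $k$ is minimal, i.e. $[S_1\cdots S_{j+1}]$ is not surjective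 for $0\le j<k$. Then: (i) For every $l\ge1$, $$\pi_{k+l}(\bar X_{2k+l-1})\supsetneq\pi_{k+l}(\bar X_{2k+l})=\pi_{k+l}(\bar X_\infty).$$ Moreover, every $[z_1,\dots,z_{2k+l}]\in\bar X_{2k+l}$ lifts to an exact solution: there is a curve $\gamma:\mathbb K\to B$, analytic near $0$, with $\gamma(0)=0$, $G[\gamma(\varepsilon)]=0$ for all small $|\varepsilon|$, and $\gamma^{(i)}(0)=z_i$ for $1\le i\le k+l$. (ii) There are operators $P_i:(N_{k+1})^{i-1}\to B$, $i\ge1$ ($P_1\in B$ a constant), such that for every $l\ge1$, with suitable further operators $P_{l+j}=P^{(l)}_{l+j}:(N_{k+1})^l\times N_k\times\dots\times N_{k-j+2}\to B$, $1\le j\le k$ (these may depend on $l$), the set $\bar X_{2k+l}$ is parametrized bijectively by $N_1\times\dots\times N_k\times(N_{k+1})^l$ through $$[z_1,\dots,z_k]=[\bar z_1,\dots,\bar z_k],$$ $$z_{k+i}=P_i(q_1,\dots,q_{i-1})+q_i,\quad q_i\in N_{k+1},\ 1\le i\le l,$$ $$z_{k+l+j}=P_{l+j}(q_1,\dots,q_l,n_k,\dots,n_{k-j+2})+n_{k-j+1},\quad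 n_{k-j+1}\in N_{k-j+1},\ 1\le j\le k.$$ Each of these operators $P_i$ is a polynomial operator of degree at most $i$, i.e. a finite sum of terms $p_d(x,\dots,x)$ with $p_d$ a continuous $d$-linear mapping, $d\le i$. If $B$ and $\bar B$ are finite-dimensional, then with respect to any linear coordinates each $P_i$ is given by polynomials of total degree at most $i$. -/

import Mathlib

open Filter Topology

namespace KRegular

noncomputable section

section Arcs

variable {𝕂 B B' : Type*} [RCLike 𝕂] [NormedAddCommGroup B] [NormedSpace 𝕂 B]
  [NormedAddCommGroup B'] [NormedSpace 𝕂 B']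

/-- The polynomial curve `ε ↦ ε z₁ + (1/2) ε² z₂ + ⋯ + (1/n!) εⁿ zₙ`.
Tuples are indexed from `0`: the entry `z i` is the coefficient `z_{i+1}`. -/
def curve {n : ℕ} (z : Fin n → B) (ε : 𝕂) : B :=
  ∑ i : Fin n, (ε ^ ((i : ℕ) + 1) / (((i : ℕ) + 1).factorial : 𝕂)) • z i

/-- `T^m[z₁, …, z_m]`, the coefficient of `ε^m / m!` in the expansion at `ε = 0` of
`G[ε z₁ + ⋯ + (1/m!) ε^m z_m]`. -/
def T (𝕂 : Type*) {B B' : Type*} [RCLike 𝕂] [NormedAddCommGroup B] [NormedSpace 𝕂 B]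
    [NormedAddCommGroup B'] [NormedSpace 𝕂 B'] (G : B → B') {m : ℕ} (z : Fin m → B) : B' :=
  iteratedDeriv m (fun ε : 𝕂 => G (curve z ε)) 0

/-- The truncation `π_l` of an `n`-tuple, `l ≤ n`. -/
def trunc {l n : ℕ} (h : l ≤ n) (z : Fin n → B) : Fin l → B := fun i => z (Fin.castLE h i)

/-- The truncation `π_l` of an infinite sequence. -/
def truncInf (l : ℕ) (z : ℕ → B) : Fin l → B := fun i => z i

/-- `X_n`: the solutions of `T¹[z₁] = 0, …, Tⁿ[z₁, …, zₙ] = 0`. -/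
def X (𝕂 : Type*) {B B' : Type*} [RCLike 𝕂] [NormedAddCommGroup B] [NormedSpace 𝕂 B]
    [NormedAddCommGroup B'] [NormedSpace 𝕂 B'] (G : B → B') (n : ℕ) : Set (Fin n → B) :=
  {z | ∀ (m : ℕ) (h : m ≤ n), 1 ≤ m → T 𝕂 G (trunc h z) = 0}

/-- `X_∞`: the sequences that satisfy all the equations `T¹ = 0, T² = 0, …`. -/
def XInf (𝕂 : Type*) {B B' : Type*} [RCLike 𝕂] [NormedAddCommGroup B] [NormedSpace 𝕂 B]
    [NormedAddCommGroup B'] [NormedSpace 𝕂 B'] (G : B → B') : Set (ℕ → B) :=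
  {z | ∀ n : ℕ, truncInf n z ∈ X 𝕂 G n}

/-- `X̄_n`, `n ≥ k`: the elements of `X_n` with leading coefficients `[z̄₁, …, z̄_k]`. -/
def XBar (𝕂 : Type*) {B B' : Type*} [RCLike 𝕂] [NormedAddCommGroup B] [NormedSpace 𝕂 B]
    [NormedAddCommGroup B'] [NormedSpace 𝕂 B'] (G : B → B') {k : ℕ} (zbar : Fin k → B)
    (n : ℕ) : Set (Fin n → B) :=
  {z | z ∈ X 𝕂 G n ∧ ∀ (i : Fin k) (j : Fin n), (i : ℕ) = (j : ℕ) → z j = zbar i}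

/-- `X̄_∞`: the elements of `X_∞` with leading coefficients `[z̄₁, …, z̄_k]`. -/
def XBarInf (𝕂 : Type*) {B B' : Type*} [RCLike 𝕂] [NormedAddCommGroup B] [NormedSpace 𝕂 B]
    [NormedAddCommGroup B'] [NormedSpace 𝕂 B'] (G : B → B') {k : ℕ} (zbar : Fin k → B) :
    Set (ℕ → B) :=
  {z | z ∈ XInf 𝕂 G ∧ truncInf k z = zbar}

end Arcs

section Iteration

variable (𝕂 : Type*) {B B' : Type*} [RCLike 𝕂] [NormedAddCommGroup B] [NormedSpace 𝕂 B]
  [NormedAddCommGroup B'] [NormedSpace 𝕂 B'] (G : B → B') {k : ℕ} (zbar : Fin k → B)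

/-- `L_t`, the coefficient of `ε^t` in the expansion at `ε = 0` of the linearization
`G'[z̄(ε)]` along `z̄(ε) = ε z̄₁ + ⋯ + (1/k!) ε^k z̄_k`. So `L₀ = G'[0]`, `L₁ = G''[0] z̄₁`,
`L₂ = (1/2) (G''[0] z̄₂ + G'''[0] z̄₁²)`; for `t ≤ k` only `z̄₁, …, z̄_t` and the first `t + 1`
derivatives of `G` at `0` enter. -/
def linCoeff (t : ℕ) : B →L[𝕂] B' :=
  ((t.factorial : 𝕂)⁻¹) • iteratedDeriv t (fun ε : 𝕂 => fderiv 𝕂 G (curve zbar ε)) 0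

/-- The coefficient of `ε^s` in `G'[z̄(ε)] (v₀ + ε v₁ + ε² v₂ + ⋯)`, i.e. `∑_{t ≤ s} L_t v_{s-t}`. -/
def residual (s : ℕ) : (ℕ → B) →ₗ[𝕂] B' :=
  ∑ t ∈ Finset.range (s + 1),
    (linCoeff 𝕂 G zbar t : B →ₗ[𝕂] B') ∘ₗ (LinearMap.proj (s - t) : (ℕ → B) →ₗ[𝕂] B)

/-- The formal perturbations `v₀ + ε v₁ + ⋯` that are annihilated by the linearization along
`z̄(ε)` in all orders below `i`. -/
def chains (i : ℕ) : Submodule 𝕂 (ℕ → B) :=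
  ⨅ s : Fin i, LinearMap.ker (residual 𝕂 G zbar (s : ℕ))

/-- The projection onto `p` along `q`, when these are complementary (and `0` otherwise). -/
def projAlong {𝕂 E : Type*} [Field 𝕂] [AddCommGroup E] [Module 𝕂 E] (p q : Submodule 𝕂 E) :
    E →ₗ[𝕂] E :=
  open Classical in if h : IsCompl p q then Submodule.projection p q h else 0

/-- The graph of `S_{i+1}`, where `Rs = R₁ ⊕ ⋯ ⊕ R_i` and `Rci = R_iᶜ` is its complement
in the target. An element `n` is mapped as follows: extend `n` to `v₀ + ε v₁ + ⋯` with `v₀ = n` such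
that all orders below `i` of the linearized system vanish, and project the order `i`, that is
`∑_{t ≤ i} L_t v_{i-t}`, to `R_iᶜ`. The factor `(2i)!/i!` is the
normalization that results from linearizing `T^{2i}` with respect to `z_i, …, z_{2i}`. Thus
`S₁ = G'[0]`, `S₂ = P ∘ 2 G''[0] z̄₁` on `N₁`, and
`S₃ = P ∘ (6 G''[0] z̄₂ + 6 G'''[0] z̄₁² - 12 G''[0] z̄₁ S₁⁻¹ P_{R₁} G''[0] z̄₁)` on `N₂`. -/
def opGraph (Rs Rci : Submodule 𝕂 B') (i : ℕ) : Submodule 𝕂 (B × B') :=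
  (chains 𝕂 G zbar i).map
    ((LinearMap.proj 0 : (ℕ → B) →ₗ[𝕂] B).prod
      (((((2 * i).factorial : 𝕂) / (i.factorial : 𝕂))) •
        (projAlong Rci Rs ∘ₗ residual 𝕂 G zbar i)))

/-- The operator with graph `opGraph`, on a subspace `N` of its domain. -/
def opOn (Rs Rci : Submodule 𝕂 B') (i : ℕ) (N : Submodule 𝕂 B) : N →ₗ[𝕂] B' :=
  open Classical in
  if h : N ≤ (opGraph 𝕂 G zbar Rs Rci i).toLinearPMap.domain then
    (opGraph 𝕂 G zbar Rs Rci i).toLinearPMap.toFun ∘ₗ Submodule.inclusion h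
  else 0

/-- The pair `(N_i, R₁ + ⋯ + R_i)`, for given complements `Rc i = R_iᶜ` (`Rc 0` is the
whole target space): `N₀ = B`, `N_{i+1}` is the null space and `R_{i+1}` the range of
`S_{i+1} : N_i → R_iᶜ`. -/
def stage (Rc : ℕ → Submodule 𝕂 B') : ℕ → Submodule 𝕂 B × Submodule 𝕂 B'
  | 0 => (⊤, ⊥)
  | i + 1 =>
    ((LinearMap.ker (opOn 𝕂 G zbar (stage Rc i).2 (Rc i) i (stage Rc i).1)).map
        (stage Rc i).1.subtype,
      (stage Rc i).2 ⊔
        LinearMap.range (opOn 𝕂 G zbar (stage Rc i).2 (Rc i) i (stage Rc i).1))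

/-- The filtration `B = N₀ ⊇ N₁ ⊇ N₂ ⊇ ⋯`. -/
def N (Rc : ℕ → Submodule 𝕂 B') (i : ℕ) : Submodule 𝕂 B := (stage 𝕂 G zbar Rc i).1

/-- The sum `R₁ + ⋯ + R_i`. -/
def Rsum (Rc : ℕ → Submodule 𝕂 B') (i : ℕ) : Submodule 𝕂 B' := (stage 𝕂 G zbar Rc i).2

/-- `S Rc i` is the operator `S_{i+1}` on `N_i`. -/
def S (Rc : ℕ → Submodule 𝕂 B') (i : ℕ) : N 𝕂 G zbar Rc i →ₗ[𝕂] B' :=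
  opOn 𝕂 G zbar (Rsum 𝕂 G zbar Rc i) (Rc i) i (N 𝕂 G zbar Rc i)

/-- The sum operator `[S₁ ⋯ S_{j+1}] : N₀ × ⋯ × N_j → B'`. -/
def sumOp (Rc : ℕ → Submodule 𝕂 B') (j : ℕ) (n : (i : Fin (j + 1)) → N 𝕂 G zbar Rc i) : B' :=
  ∑ i : Fin (j + 1), S 𝕂 G zbar Rc i (n i)

/-- The decomposition conditions of the iteration up to `S_{k+1}`: for `i = 0, …, k` there are
direct sums `N_i = N_{i+1}ᶜ ⊕ N_{i+1}` and `R_iᶜ = R_{i+1} ⊕ R_{i+1}ᶜ` of closed subspaces, with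
`N_{i+1}` the null space and `R_{i+1}` the range of `S_{i+1}` (and `R₀ᶜ` the whole target). -/
structure IsDecomposition (Nc : ℕ → Submodule 𝕂 B) (Rc : ℕ → Submodule 𝕂 B') : Prop where
  Rc_zero : Rc 0 = ⊤
  Nc_closed : ∀ i ≤ k, IsClosed (Nc (i + 1) : Set B)
  Nc_disjoint : ∀ i ≤ k, Disjoint (Nc (i + 1)) (N 𝕂 G zbar Rc (i + 1))
  Nc_sup : ∀ i ≤ k, Nc (i + 1) ⊔ N 𝕂 G zbar Rc (i + 1) = N 𝕂 G zbar Rc i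
  R_closed : ∀ i ≤ k, IsClosed (LinearMap.range (S 𝕂 G zbar Rc i) : Set B')
  Rc_closed : ∀ i ≤ k, IsClosed (Rc (i + 1) : Set B')
  R_disjoint : ∀ i ≤ k, Disjoint (LinearMap.range (S 𝕂 G zbar Rc i)) (Rc (i + 1))
  R_sup : ∀ i ≤ k, LinearMap.range (S 𝕂 G zbar Rc i) ⊔ Rc (i + 1) = Rc i

/-- `[z̄₁, …, z̄_k]` is regular of degree `k`: it consists of the leading coefficients of an element
of `X̄_{2k}`, the decomposition conditions hold with the chosen complements,
and `[S₁ ⋯ S_{k+1}]` is surjective. -/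
structure IsRegular (Nc : ℕ → Submodule 𝕂 B) (Rc : ℕ → Submodule 𝕂 B') : Prop where
  leading : (XBar 𝕂 G zbar (2 * k)).Nonempty
  decomposition : IsDecomposition 𝕂 G zbar Nc Rc
  surjective : Function.Surjective (sumOp 𝕂 G zbar Rc k)

end Iteration

section Polynomial

variable {𝕂 E F : Type*} [RCLike 𝕂] [NormedAddCommGroup E] [NormedSpace 𝕂 E]
  [NormedAddCommGroup F] [NormedSpace 𝕂 F]

/-- `f` is a polynomial operator of degree at most `d`, built from continuous multilinear
mappings: `f x = ∑_{j ≤ d} p_j(x, …, x)` with `p_j` continuous and `j`-linear. -/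
def IsPolyOp (𝕂 : Type*) {E F : Type*} [RCLike 𝕂] [NormedAddCommGroup E] [NormedSpace 𝕂 E]
    [NormedAddCommGroup F] [NormedSpace 𝕂 F] (d : ℕ) (f : E → F) : Prop :=
  ∃ p : (j : ℕ) → ContinuousMultilinearMap 𝕂 (fun _ : Fin j => E) F,
    ∀ x, f x = ∑ j ∈ Finset.range (d + 1), p j (fun _ => x)

/-- With respect to arbitrary linear coordinates on `E` and `F`, the coordinates of `f x` are
polynomials of total degree at most `d` in the coordinates of `x`. -/
def IsPolyInCoordinates (𝕂 : Type*) {E F : Type*} [RCLike 𝕂] [NormedAddCommGroup E]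
    [NormedSpace 𝕂 E] [NormedAddCommGroup F] [NormedSpace 𝕂 F] (d : ℕ) (f : E → F) : Prop :=
  ∀ (r s : ℕ) (e : Module.Basis (Fin r) 𝕂 E) (c : Module.Basis (Fin s) 𝕂 F),
    ∃ p : Fin s → MvPolynomial (Fin r) 𝕂, (∀ j, (p j).totalDegree ≤ d) ∧
      ∀ x j, c.repr (f x) j = MvPolynomial.eval (fun i => e.repr x i) (p j)

end Polynomial

section Parametrization

variable {𝕂 B : Type*} [RCLike 𝕂] [NormedAddCommGroup B] [NormedSpace 𝕂 B]

/-- The tuple of length `2k + l = k + l + k` with entries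
`z_i = z̄_i` for `i ≤ k`, `z_{k+i} = P_i(q₁, …, q_{i-1}) + q_i` for `1 ≤ i ≤ l`, and
`z_{k+l+j} = P_{l+j}(q₁, …, q_l, n_k, …, n_{k-j+2}) + n_{k-j+1}` for `1 ≤ j ≤ k`,
where `q_i ∈ N_{k+1}`, `n_i ∈ N_i`.
Indices are shifted to `0`: `q i` is `q_{i+1}`, `n j` is `n_{k-j}`, `P i` is `P_{i+1}` and
`Q j` is `P_{l+j+1}`. -/
def paramPoint {k l : ℕ} (N : ℕ → Submodule 𝕂 B) (zbar : Fin k → B)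
    (P : (i : ℕ) → (Fin i → N (k + 1)) → B)
    (Q : (j : Fin k) → (Fin l → N (k + 1)) × ((i : Fin j) → N (k - i)) → B)
    (a : (Fin l → N (k + 1)) × ((j : Fin k) → N (k - j))) : Fin (k + l + k) → B :=
  Fin.append
    (Fin.append zbar
      (fun i : Fin l => P i (fun j : Fin i => a.1 (Fin.castLE i.2.le j)) + (a.1 i : B)))
    (fun j : Fin k => Q j (a.1, fun i : Fin j => a.2 (Fin.castLE j.2.le i)) + (a.2 j : B))

end Parametrization

end

end KRegular

/-! Perturb an arc starting with `z̄` by `ε^(M+1) (v₀ + ε v₁ + ⋯)`, where `M ≥ k`. The arc deviates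
from `z̄(ε)` by `O(ε^(k+1))`, so replacing `G` by its linearization along `z̄` costs only
`O(ε^(M+k+2))`. Hence the coefficients of order `M+1, …, M+1+k` of `G` change exactly by the
residuals `∑ L_t v_{s-t}`, `0 ≤ s ≤ k` (`arcCoeff_sub_eq_residual`). In this window the nonlinear
problem is linear, and the linear problem is the same for every `M`.

The iteration solves this linear problem. Call `v` a chain of length `i` if its residuals of order
below `i` vanish. Then `N_i` consists of the leading entries `v₀` of chains of length `i`, and `R₁ ⊕
⋯ ⊕ R_i` of the residuals of order `i` of those chains with `v₀ = 0` (`StageData`). Surjectivity of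
the sum operator says that every element of the target is the residual of order `k` of a chain of
length `k`; the closed complements and the open mapping theorem make the choice `A` of this chain
continuous and linear (`StageData.exists_chain_residual`).

Therefore a solution of order `M+k` is corrected to order `M+k+1` by a chain that leaves the first
`M` coefficients alone. Repetition gives formal solutions. The freedom left in each coefficient is
`N_{k+1}`, except for the last `k` ones, where fewer equations are imposed and the freedom is `N_k,
…, N_1`. Minimality of `k` forces `N_{k+1} ≠ N_k`, which makes the inclusion strict.

For an exact solution the correction `A y` is inserted with unknown `y`. With `n = M+1+k` this gives
`G = ε^n (y - y₀ + O(ε))`; after division by `ε^n` the implicit function theorem yields `y = ψ(ε)`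
(`exists_analytic_solution`). The degree bounds follow from the formula of Faà di Bruno by
induction, where the coefficient of order `r` has degree at most `r - k` (and `0` for `r ≤ k`);
`sum_min_sub_le` is the count behind it. -/

namespace KRegular

noncomputable section

/-! ### Taylor coefficients and uniqueness of finite expansions. -/

section Expansion

open Asymptotics

variable {𝕂 F : Type*} [RCLike 𝕂] [NormedAddCommGroup F] [NormedSpace 𝕂 F]

/-- The `m`-th Taylor coefficient of `f` at `0`. -/
def tcoeff (f : 𝕂 → F) (m : ℕ) : F := ((m.factorial : 𝕂)⁻¹) • iteratedDeriv m f 0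

theorem tcoeff_eq_coeff [CompleteSpace F] {f : 𝕂 → F} {p : FormalMultilinearSeries 𝕂 𝕂 F}
    (hp : HasFPowerSeriesAt f p 0) (m : ℕ) : tcoeff f m = p.coeff m := by
  obtain ⟨r, hr⟩ := hp
  have h := hr.factorial_smul 1 m
  rw [tcoeff, iteratedDeriv_eq_iteratedFDeriv, ← h, ← Nat.cast_smul_eq_nsmul 𝕂, smul_smul,
    inv_mul_cancel₀ (by exact_mod_cast m.factorial_ne_zero), one_smul]
  rfl

theorem tcoeff_expansion [CompleteSpace F] {f : 𝕂 → F} (hf : AnalyticAt 𝕂 f 0) (n : ℕ) :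
    (fun ε => f ε - ∑ m ∈ Finset.range n, ε ^ m • tcoeff f m) =O[𝓝 0] fun ε : 𝕂 => ε ^ n := by
  obtain ⟨p, hp⟩ := hf
  have h := hp.isBigO_sub_partialSum_pow n
  simp only [zero_add, FormalMultilinearSeries.partialSum] at h
  refine IsBigO.trans (h.congr_left fun ε => ?_) (IsBigO.of_bound 1 (Eventually.of_forall fun ε => by simp))
  congr 1
  refine Finset.sum_congr rfl fun m _ => ?_
  rw [tcoeff_eq_coeff hp, FormalMultilinearSeries.apply_eq_pow_smul_coeff]

/-- The limit `ε → 0` kills the constant term, and division by `ε` lowers `n`. The punctured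
neighbourhood is what permits this division. -/
theorem eq_zero_of_sum_isBigO (n : ℕ) (c : ℕ → F)
    (h : (fun ε : 𝕂 => ∑ m ∈ Finset.range n, ε ^ m • c m) =O[𝓝[≠] 0] fun ε : 𝕂 => ε ^ n) :
    ∀ m < n, c m = 0 := by
  induction n generalizing c with
  | zero => intro m hm; omega
  | succ n ih =>
    have e : ∀ ε : 𝕂, ∑ m ∈ Finset.range (n + 1), ε ^ m • c m
        = c 0 + ε • ∑ m ∈ Finset.range n, ε ^ m • c (m + 1) := by
      intro ε
      rw [Finset.sum_range_succ', Finset.smul_sum, add_comm]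
      simp [pow_succ', smul_smul]
    have h0 : c 0 = 0 := by
      have t1 : Tendsto (fun ε : 𝕂 => ∑ m ∈ Finset.range (n + 1), ε ^ m • c m) (𝓝[≠] 0)
          (𝓝 (c 0)) := by
        have : Continuous (fun ε : 𝕂 => ∑ m ∈ Finset.range (n + 1), ε ^ m • c m) := by fun_prop
        have := (this.tendsto 0).mono_left (nhdsWithin_le_nhds (s := {0}ᶜ))
        simpa [e] using this
      have t2 : Tendsto (fun ε : 𝕂 => ε ^ (n + 1)) (𝓝[≠] 0) (𝓝 0) := by
        have : Continuous (fun ε : 𝕂 => ε ^ (n + 1)) := by fun_prop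
        have := (this.tendsto 0).mono_left (nhdsWithin_le_nhds (s := {0}ᶜ))
        simpa using this
      exact tendsto_nhds_unique t1 (h.trans_tendsto t2)
    have h1 : (fun ε : 𝕂 => ∑ m ∈ Finset.range n, ε ^ m • c (m + 1)) =O[𝓝[≠] 0]
        fun ε : 𝕂 => ε ^ n := by
      have := (isBigO_refl (fun ε : 𝕂 => ε⁻¹) (𝓝[≠] 0)).smul h
      refine this.congr' ?_ ?_
      · filter_upwards [self_mem_nhdsWithin] with ε (hε : ε ≠ 0)
        rw [e, h0, zero_add, smul_smul, inv_mul_cancel₀ hε, one_smul]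
      · filter_upwards [self_mem_nhdsWithin] with ε (hε : ε ≠ 0)
        rw [smul_eq_mul, pow_succ']
        field_simp
    intro m hm
    rcases m with _ | m
    · exact h0
    · exact ih _ h1 m (by omega)

theorem tcoeff_eq_of_isBigO [CompleteSpace F] {f : 𝕂 → F} (hf : AnalyticAt 𝕂 f 0) {n : ℕ}
    {c : ℕ → F}
    (h : (fun ε => f ε - ∑ m ∈ Finset.range n, ε ^ m • c m) =O[𝓝 0] fun ε : 𝕂 => ε ^ n) :
    ∀ m < n, tcoeff f m = c m := by
  have h1 := (h.sub (tcoeff_expansion hf n)).mono (nhdsWithin_le_nhds (s := {0}ᶜ))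
  have h2 := eq_zero_of_sum_isBigO n (fun m => tcoeff f m - c m) (h1.congr_left fun ε => by
    simp [smul_sub, Finset.sum_sub_distrib])
  intro m hm
  exact sub_eq_zero.1 (h2 m hm)

theorem tcoeff_congr_of_isBigO [CompleteSpace F] {f g : 𝕂 → F} (hf : AnalyticAt 𝕂 f 0)
    (hg : AnalyticAt 𝕂 g 0) {n : ℕ} (h : (fun ε => f ε - g ε) =O[𝓝 0] fun ε : 𝕂 => ε ^ n) :
    ∀ m < n, tcoeff f m = tcoeff g m :=
  tcoeff_eq_of_isBigO hf ((h.add (tcoeff_expansion hg n)).congr_left fun ε => by abel)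

theorem isBigO_pow_pow {m n : ℕ} (h : m ≤ n) :
    (fun ε : 𝕂 => ε ^ n) =O[𝓝 0] fun ε : 𝕂 => ε ^ m := by
  obtain ⟨d, rfl⟩ := Nat.exists_eq_add_of_le h
  have h1 : (fun ε : 𝕂 => ε ^ d) =O[𝓝 0] fun _ : 𝕂 => (1 : 𝕂) :=
    ((continuous_pow d).tendsto (0 : 𝕂)).isBigO_one 𝕂
  simpa [pow_add] using (isBigO_refl (fun ε : 𝕂 => ε ^ m) (𝓝 0)).mul h1

theorem isBigO_pow_smul_const {m n : ℕ} (h : m ≤ n) (x : F) :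
    (fun ε : 𝕂 => ε ^ n • x) =O[𝓝 0] fun ε : 𝕂 => ε ^ m := by
  have := (isBigO_pow_pow (𝕂 := 𝕂) h).smul (isBigO_refl (fun _ : 𝕂 => x) (𝓝 0))
  refine this.trans ?_
  refine IsBigO.of_bound ‖x‖ (Eventually.of_forall fun ε => ?_)
  rw [norm_smul, mul_comm]

end Expansion

/-! ### Coefficients of `G` along polynomial arcs. -/

section Arc

open Asymptotics

variable {𝕂 B B' : Type*} [RCLike 𝕂] [NormedAddCommGroup B] [NormedSpace 𝕂 B]
  [NormedAddCommGroup B'] [NormedSpace 𝕂 B']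

/-- The polynomial arc `ε ↦ ε a₀ + ε² a₁ + ⋯ + εⁿ aₙ₋₁`. -/
def arc (a : ℕ → B) (n : ℕ) (ε : 𝕂) : B := ∑ i ∈ Finset.range n, ε ^ (i + 1) • a i

/-- The coefficient of `ε^m` in the expansion of `G` along the formal arc `ε a₀ + ε² a₁ + ⋯`. -/
def arcCoeff (𝕂 : Type*) {B B' : Type*} [RCLike 𝕂] [NormedAddCommGroup B] [NormedSpace 𝕂 B]
    [NormedAddCommGroup B'] [NormedSpace 𝕂 B'] (G : B → B') (a : ℕ → B) (m : ℕ) : B' :=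
  tcoeff (fun ε : 𝕂 => G (arc a m ε)) m

@[simp] theorem arc_zero (a : ℕ → B) (n : ℕ) : arc a n (0 : 𝕂) = 0 := by simp [arc]

@[fun_prop]
theorem continuous_arc (a : ℕ → B) (n : ℕ) : Continuous (arc a n : 𝕂 → B) := by
  unfold arc; fun_prop

theorem analyticAt_arc (a : ℕ → B) (n : ℕ) (x : 𝕂) : AnalyticAt 𝕂 (arc a n : 𝕂 → B) x := by
  unfold arc; fun_prop

theorem tendsto_arc (a : ℕ → B) (n : ℕ) : Tendsto (arc a n : 𝕂 → B) (𝓝 0) (𝓝 0) := by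
  simpa using (continuous_arc (𝕂 := 𝕂) a n).tendsto 0

theorem analyticAt_comp_arc {G : B → B'} (hG : AnalyticAt 𝕂 G 0) (a : ℕ → B) (n : ℕ) :
    AnalyticAt 𝕂 (fun ε : 𝕂 => G (arc a n ε)) 0 :=
  AnalyticAt.fun_comp (by simpa using hG) (analyticAt_arc a n 0)

theorem arc_congr {a b : ℕ → B} {n : ℕ} (h : ∀ i < n, a i = b i) :
    (arc a n : 𝕂 → B) = arc b n := by
  ext ε
  exact Finset.sum_congr rfl fun i hi => by rw [h i (Finset.mem_range.1 hi)]

theorem arcCoeff_congr {G : B → B'} {a b : ℕ → B} {m : ℕ} (h : ∀ i < m, a i = b i) :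
    arcCoeff 𝕂 G a m = arcCoeff 𝕂 G b m := by
  rw [arcCoeff, arcCoeff, arc_congr h]

theorem arc_isBigO {a : ℕ → B} {M n : ℕ} (h : ∀ i < M, a i = 0) :
    (fun ε => arc a n ε) =O[𝓝 0] fun ε : 𝕂 => ε ^ (M + 1) := by
  unfold arc
  refine IsBigO.fun_sum (A := fun i (ε : 𝕂) => ε ^ (i + 1) • a i) fun i _ => ?_
  by_cases hi : i < M
  · simp only [h i hi, smul_zero]; exact isBigO_zero (fun ε : 𝕂 => ε ^ (M + 1)) (𝓝 0)
  · exact isBigO_pow_smul_const (by omega) _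

theorem arc_sub_isBigO {a b : ℕ → B} {M n n' : ℕ} (h : ∀ i < M, a i = b i) (hn : M ≤ n)
    (hn' : M ≤ n') :
    (fun ε => arc a n ε - arc b n' ε) =O[𝓝 0] fun ε : 𝕂 => ε ^ (M + 1) := by
  -- Padding by zeros makes the difference of arcs of different lengths a single arc of length `max
  -- n n'`.
  have key : ∀ ε : 𝕂, arc a n ε - arc b n' ε =
      arc (fun i => (if i < n then a i else 0) - (if i < n' then b i else 0)) (max n n') ε := by
    intro ε
    simp only [arc, smul_sub, Finset.sum_sub_distrib]
    congr 1
    · rw [← Finset.sum_subset (Finset.range_subset_range.2 (le_max_left n n'))]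
      · exact Finset.sum_congr rfl fun i hi => by rw [if_pos (Finset.mem_range.1 hi)]
      · intro i _ hi; rw [if_neg (by simpa using hi), smul_zero]
    · rw [← Finset.sum_subset (Finset.range_subset_range.2 (le_max_right n n'))]
      · exact Finset.sum_congr rfl fun i hi => by rw [if_pos (Finset.mem_range.1 hi)]
      · intro i _ hi; rw [if_neg (by simpa using hi), smul_zero]
  simp only [key]
  refine arc_isBigO fun i hi => ?_
  rw [if_pos (by omega), if_pos (by omega), h i hi, sub_self]

theorem comp_sub_isBigO {G : B → B'} (hG : AnalyticAt 𝕂 G 0) {x y : 𝕂 → B}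
    (hx : Tendsto x (𝓝 0) (𝓝 0)) (hy : Tendsto y (𝓝 0) (𝓝 0)) :
    (fun ε => G (x ε) - G (y ε)) =O[𝓝 0] fun ε => x ε - y ε :=
  hG.hasStrictFDerivAt.isBigO_sub.comp_tendsto (k := fun ε => (x ε, y ε))
    (by simpa using hx.prodMk_nhds hy)

variable [CompleteSpace B']

/-- The omitted tail is `O(ε^(m+1))` and `G` is Lipschitz near `0`, so entries of index `m` and
above do not reach order `m`. -/
theorem tcoeff_comp_arc {G : B → B'} (hG : AnalyticAt 𝕂 G 0) (a : ℕ → B) {m n : ℕ} (h : m ≤ n) :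
    tcoeff (fun ε : 𝕂 => G (arc a n ε)) m = arcCoeff 𝕂 G a m :=
  tcoeff_congr_of_isBigO (analyticAt_comp_arc hG a n) (analyticAt_comp_arc hG a m)
    ((comp_sub_isBigO hG (tendsto_arc a n) (tendsto_arc a m)).trans
      (arc_sub_isBigO (M := m) (fun _ _ => rfl) h le_rfl)) m (Nat.lt_succ_self m)

theorem comp_arc_expansion {G : B → B'} (hG : AnalyticAt 𝕂 G 0) (a : ℕ → B) (n : ℕ) :
    (fun ε : 𝕂 => G (arc a n ε) - ∑ m ∈ Finset.range (n + 1), ε ^ m • arcCoeff 𝕂 G a m)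
      =O[𝓝 0] fun ε : 𝕂 => ε ^ (n + 1) := by
  refine (tcoeff_expansion (analyticAt_comp_arc hG a n) (n + 1)).congr_left fun ε => ?_
  congr 1
  refine Finset.sum_congr rfl fun m hm => ?_
  rw [tcoeff_comp_arc hG a (by simpa [Nat.lt_succ_iff] using hm)]

end Arc

/-! ### Linearization along `z̄`. -/

section Perturbation

open Asymptotics

variable {𝕂 B B' : Type*} [RCLike 𝕂] [NormedAddCommGroup B] [NormedSpace 𝕂 B]
  [NormedAddCommGroup B'] [NormedSpace 𝕂 B']

/-- The coefficients `zᵢ / i!` of a tuple, continued by zero to a sequence. -/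
def normalize (𝕂 : Type*) {B : Type*} [RCLike 𝕂] [NormedAddCommGroup B] [NormedSpace 𝕂 B]
    {n : ℕ} (z : Fin n → B) (i : ℕ) : B :=
  if h : i < n then (((i + 1).factorial : 𝕂)⁻¹) • z ⟨i, h⟩ else 0

theorem curve_eq_arc {n : ℕ} (z : Fin n → B) : (curve z : 𝕂 → B) = arc (normalize 𝕂 z) n := by
  ext ε
  rw [curve, arc, Finset.sum_range]
  refine Finset.sum_congr rfl fun i _ => ?_
  rw [normalize, dif_pos i.2, smul_smul, div_eq_mul_inv]

/-- Mean value inequality on the segment from `y` to `x`, with `G'` Lipschitz near `0`. The base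
point `c` is kept separate because the derivative will be taken along `z̄`, from which both arcs
have already departed. -/
theorem exists_linearization_bound [CompleteSpace B'] {G : B → B'} (hG : AnalyticAt 𝕂 G 0) :
    ∃ K : ℝ, ∃ r > 0, ∀ x ∈ Metric.ball (0 : B) r, ∀ y ∈ Metric.ball (0 : B) r,
      ∀ c ∈ Metric.ball (0 : B) r,
      ‖G x - G y - fderiv 𝕂 G c (x - y)‖ ≤ K * (‖x - c‖ + ‖y - c‖) * ‖x - y‖ := by
  obtain ⟨K, s, hs, hK⟩ := (hG.fderiv.hasStrictFDerivAt).exists_lipschitzOnWith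
  obtain ⟨r, hr, hb⟩ := Metric.mem_nhds_iff.1
    (inter_mem hs hG.eventually_analyticAt)
  refine ⟨K, r, hr, fun x hx y hy c hc => ?_⟩
  let _ : NormedSpace ℝ B := NormedSpace.restrictScalars ℝ 𝕂 B
  have hseg : segment ℝ y x ⊆ Metric.ball (0 : B) r := (convex_ball 0 r).segment_subset hy hx
  refine (convex_segment y x).norm_image_sub_le_of_norm_fderiv_le' (𝕜 := 𝕂)
    (fun z hz => (hb (hseg hz)).2.differentiableAt) (fun z hz => ?_)
    (left_mem_segment ℝ y x) (right_mem_segment ℝ y x)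
  have h1 := hK.dist_le_mul z (hb (hseg hz)).1 c (hb hc).1
  rw [dist_eq_norm, dist_eq_norm] at h1
  refine h1.trans (mul_le_mul_of_nonneg_left ?_ K.2)
  have h2 : z ∈ Metric.closedBall c (‖x - c‖ + ‖y - c‖) :=
    (convex_closedBall c _).segment_subset (by simp [dist_eq_norm]) (by simp [dist_eq_norm]) hz
  simpa [dist_eq_norm] using h2

theorem linearization_isBigO [CompleteSpace B'] {G : B → B'} (hG : AnalyticAt 𝕂 G 0)
    {x y c : 𝕂 → B} (hx : Tendsto x (𝓝 0) (𝓝 0)) (hy : Tendsto y (𝓝 0) (𝓝 0))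
    (hc : Tendsto c (𝓝 0) (𝓝 0)) {p q : ℕ}
    (hxy : (fun ε => x ε - y ε) =O[𝓝 0] fun ε : 𝕂 => ε ^ p)
    (hxc : (fun ε => x ε - c ε) =O[𝓝 0] fun ε : 𝕂 => ε ^ q)
    (hyc : (fun ε => y ε - c ε) =O[𝓝 0] fun ε : 𝕂 => ε ^ q) :
    (fun ε => G (x ε) - G (y ε) - fderiv 𝕂 G (c ε) (x ε - y ε))
      =O[𝓝 0] fun ε : 𝕂 => ε ^ (q + p) := by
  obtain ⟨K, r, hr, hK⟩ := exists_linearization_bound hG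
  have h1 : (fun ε => G (x ε) - G (y ε) - fderiv 𝕂 G (c ε) (x ε - y ε)) =O[𝓝 0]
      fun ε => (‖x ε - c ε‖ + ‖y ε - c ε‖) * ‖x ε - y ε‖ := by
    refine IsBigO.of_bound K ?_
    filter_upwards [hx (Metric.ball_mem_nhds 0 hr), hy (Metric.ball_mem_nhds 0 hr),
      hc (Metric.ball_mem_nhds 0 hr)] with ε h1 h2 h3
    rw [Real.norm_of_nonneg (by positivity), ← mul_assoc]
    exact hK _ h1 _ h2 _ h3
  refine h1.trans ?_
  have h2 := (hxc.norm_left.add hyc.norm_left).mul hxy.norm_left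
  simpa [pow_add] using h2

theorem residual_apply (G : B → B') {k : ℕ} (zbar : Fin k → B) (s : ℕ) (v : ℕ → B) :
    residual 𝕂 G zbar s v = ∑ t ∈ Finset.range (s + 1), linCoeff 𝕂 G zbar t (v (s - t)) := by
  simp [residual, LinearMap.sum_apply]

theorem linearization_expansion [CompleteSpace B'] {G : B → B'} (hG : AnalyticAt 𝕂 G 0) {k : ℕ}
    (zbar : Fin k → B) (v : ℕ → B) (n : ℕ) :
    (fun ε : 𝕂 => fderiv 𝕂 G (curve zbar ε) (∑ j ∈ Finset.range n, ε ^ j • v j) -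
      ∑ s ∈ Finset.range n, ε ^ s • residual 𝕂 G zbar s v) =O[𝓝 0] fun ε : 𝕂 => ε ^ n := by
  have hL : AnalyticAt 𝕂 (fun ε : 𝕂 => fderiv 𝕂 G (curve zbar ε)) 0 := by
    rw [curve_eq_arc]; exact analyticAt_comp_arc hG.fderiv _ _
  have hv : (fun ε : 𝕂 => ∑ j ∈ Finset.range n, ε ^ j • v j) =O[𝓝 0] fun _ => (1 : 𝕂) := by
    have : Continuous (fun ε : 𝕂 => ∑ j ∈ Finset.range n, ε ^ j • v j) := by fun_prop
    exact (this.tendsto 0).isBigO_one 𝕂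
  have h1 : (fun ε : 𝕂 => (fderiv 𝕂 G (curve zbar ε) - ∑ t ∈ Finset.range n,
      ε ^ t • linCoeff 𝕂 G zbar t) (∑ j ∈ Finset.range n, ε ^ j • v j))
      =O[𝓝 0] fun ε : 𝕂 => ε ^ n := by
    refine (IsBigO.of_bound 1 (Eventually.of_forall fun ε => ?_)).trans
      (((tcoeff_expansion hL n).norm_left.mul hv.norm_left).trans
        (by simpa using isBigO_refl (fun ε : 𝕂 => ε ^ n) (𝓝 0)))
    rw [one_mul, Real.norm_of_nonneg (by positivity)]
    exact ContinuousLinearMap.le_opNorm _ _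
  -- The products of total order at least `n`, which the sum of the residuals does not contain.
  have h2 : (fun ε : 𝕂 => ∑ t ∈ Finset.range n, ∑ j ∈ Finset.Ico (n - t) n,
      ε ^ (t + j) • linCoeff 𝕂 G zbar t (v j)) =O[𝓝 0] fun ε : 𝕂 => ε ^ n := by
    refine IsBigO.fun_sum (A := fun t (ε : 𝕂) => ∑ j ∈ Finset.Ico (n - t) n,
      ε ^ (t + j) • linCoeff 𝕂 G zbar t (v j)) fun t ht => ?_
    refine IsBigO.fun_sum (A := fun j (ε : 𝕂) => ε ^ (t + j) • linCoeff 𝕂 G zbar t (v j))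
      fun j hj => isBigO_pow_smul_const ?_ _
    have := (Finset.mem_Ico.1 hj).1
    omega
  refine (h1.add h2).congr_left fun ε => ?_
  have e1 : (∑ t ∈ Finset.range n, ε ^ t • linCoeff 𝕂 G zbar t)
      (∑ j ∈ Finset.range n, ε ^ j • v j) = ∑ t ∈ Finset.range n, ∑ j ∈ Finset.range n,
      ε ^ (t + j) • linCoeff 𝕂 G zbar t (v j) := by
    simp only [sum_apply, smul_apply, map_sum, map_smul, Finset.smul_sum, smul_smul, pow_add]
    rw [Finset.sum_comm]
    exact Finset.sum_congr rfl fun t _ => Finset.sum_congr rfl fun j _ => by rw [mul_comm]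
  have e2 : ∑ s ∈ Finset.range n, ε ^ s • residual 𝕂 G zbar s v = ∑ t ∈ Finset.range n,
      ∑ j ∈ Finset.range (n - t), ε ^ (t + j) • linCoeff 𝕂 G zbar t (v j) := by
    rw [← Finset.sum_range_diag_flip n
      (fun t j => ε ^ (t + j) • linCoeff 𝕂 G zbar t (v j))]
    refine Finset.sum_congr rfl fun s _ => ?_
    rw [residual_apply, Finset.smul_sum]
    refine Finset.sum_congr rfl fun t ht => ?_
    rw [Nat.add_sub_of_le (by simpa [Nat.lt_succ_iff] using ht)]
  have e3 : ∀ t, ∑ j ∈ Finset.range n, ε ^ (t + j) • linCoeff 𝕂 G zbar t (v j) =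
      ∑ j ∈ Finset.range (n - t), ε ^ (t + j) • linCoeff 𝕂 G zbar t (v j) +
      ∑ j ∈ Finset.Ico (n - t) n, ε ^ (t + j) • linCoeff 𝕂 G zbar t (v j) := fun t =>
    (Finset.sum_range_add_sum_Ico _ (Nat.sub_le n t)).symm
  simp only [sub_apply, e1, e2, e3, Finset.sum_add_distrib]
  abel

/-- If two arcs start with `z̄` and agree in the first `M ≥ k` coefficients, then the next `k + 1`
coefficients of `G` along them differ by the linearization along `z̄` of their difference. -/
theorem arcCoeff_sub_eq_residual [CompleteSpace B'] {G : B → B'} (hG : AnalyticAt 𝕂 G 0) {k : ℕ}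
    (zbar : Fin k → B) {a b : ℕ → B} {M : ℕ} (hM : k ≤ M)
    (ha : ∀ i < k, a i = normalize 𝕂 zbar i) (hab : ∀ i < M, b i = a i) {s : ℕ} (hs : s ≤ k) :
    arcCoeff 𝕂 G b (M + 1 + s) - arcCoeff 𝕂 G a (M + 1 + s) =
      residual 𝕂 G zbar s (fun j => b (M + j) - a (M + j)) := by
  set n := M + 1 + k with hn
  set u : ℕ → B := fun j => b (M + j) - a (M + j) with hu
  have hd : ∀ ε : 𝕂, arc b n ε - arc a n ε = ε ^ (M + 1) • ∑ j ∈ Finset.range (k + 1), ε ^ j • u j := by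
    intro ε
    rw [arc, arc, ← Finset.sum_sub_distrib, hn, add_assoc, Finset.sum_range_add,
      Finset.sum_eq_zero, zero_add, Finset.smul_sum, add_comm 1 k]
    · refine Finset.sum_congr rfl fun j _ => ?_
      rw [smul_smul, ← pow_add, ← smul_sub, hu]
      congr 2; omega
    · intro i hi
      rw [hab i (Finset.mem_range.1 hi), sub_self]
  -- The arcs differ by `O(ε^(M+1))` and lie within `O(ε^(k+1))` of `z̄`, so the error is
  -- `O(ε^(M+k+2))`, beyond the last order `n = M+1+k` considered.
  have h1 := linearization_isBigO hG (tendsto_arc (𝕂 := 𝕂) b n) (tendsto_arc a n)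
    (tendsto_arc (normalize 𝕂 zbar) k) (arc_sub_isBigO hab (by omega) (by omega))
    (arc_sub_isBigO (M := k) (fun i hi => (hab i (by omega)).trans (ha i hi)) (by omega) le_rfl)
    (arc_sub_isBigO (M := k) ha (by omega) le_rfl)
  have h2 := (isBigO_refl (fun ε : 𝕂 => ε ^ (M + 1)) (𝓝 0)).smul
    (linearization_expansion hG zbar u (k + 1))
  simp only [smul_eq_mul, ← pow_add] at h2
  rw [add_comm (k + 1) (M + 1)] at h1
  have h3 := (comp_arc_expansion (𝕂 := 𝕂) hG b n).sub (comp_arc_expansion hG a n)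
  have e : M + 1 + (k + 1) = n + 1 := by omega
  rw [e] at h1 h2
  have h4 := (h1.add h2).sub h3
  have h5 := eq_zero_of_sum_isBigO (n + 1) (fun m => arcCoeff 𝕂 G b m - arcCoeff 𝕂 G a m -
    if M + 1 ≤ m then residual 𝕂 G zbar (m - (M + 1)) u else 0)
    ((h4.mono nhdsWithin_le_nhds).congr_left fun ε => ?_) (M + 1 + s) (by omega)
  · simpa [sub_eq_zero] using h5
  · have e2 : ∑ m ∈ Finset.range (n + 1), ε ^ m •
        (if M + 1 ≤ m then residual 𝕂 G zbar (m - (M + 1)) u else 0) =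
        ε ^ (M + 1) • ∑ s ∈ Finset.range (k + 1), ε ^ s • residual 𝕂 G zbar s u := by
      rw [← e, Finset.sum_range_add, Finset.sum_eq_zero, zero_add, Finset.smul_sum]
      · refine Finset.sum_congr rfl fun j _ => ?_
        rw [if_pos (by omega), smul_smul, ← pow_add]
        congr 2
        simp
      · intro i hi
        rw [if_neg (by have := Finset.mem_range.1 hi; omega), smul_zero]
    simp only [smul_sub, Finset.sum_sub_distrib, e2, hd, curve_eq_arc, map_smul]
    abel

end Perturbation

/-! ### Bounded right inverses on closed ranges. -/

section RightInverse

/-- On the closed complement `C` of the kernel the operator is injective with the same closed range,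
hence an isomorphism onto it by the open mapping theorem. -/
theorem exists_rightInverse_on_range {𝕂 X Y : Type*} [RCLike 𝕂] [NormedAddCommGroup X]
    [NormedSpace 𝕂 X] [CompleteSpace X] [NormedAddCommGroup Y] [NormedSpace 𝕂 Y] [CompleteSpace Y]
    (f : X →L[𝕂] Y) (hf : IsClosed (f.range : Set Y)) (C : Submodule 𝕂 X)
    (hC : IsClosed (C : Set X)) (hd : Disjoint C f.ker) (hs : C ⊔ f.ker = ⊤) :
    ∃ m : f.range →L[𝕂] X, ∀ y, f (m y) = y := by
  have := hC.completeSpace_coe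
  set g : C →L[𝕂] Y := f ∘L C.subtypeL
  have hinj : Function.Injective g := by
    refine (injective_iff_map_eq_zero g).2 fun x hx => ?_
    exact Subtype.ext (Submodule.disjoint_def.1 hd x x.2 hx)
  have hrange : g.range = f.range := by
    refine le_antisymm ?_ ?_
    · rintro _ ⟨x, rfl⟩; exact ⟨x, rfl⟩
    · rintro _ ⟨x, rfl⟩
      obtain ⟨c, hc, n, hn, rfl⟩ := Submodule.mem_sup.1 (hs ▸ Submodule.mem_top : x ∈ C ⊔ f.ker)
      exact ⟨⟨c, hc⟩, by simpa [g] using (LinearMap.mem_ker.1 hn)⟩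
  have hclo : IsClosed (Set.range g) := by
    have : Set.range g = (f.range : Set Y) := by rw [← hrange]; rfl
    rwa [this]
  set e := g.equivRange hinj hclo
  refine ⟨C.subtypeL ∘L (e.symm : g.range →L[𝕂] C) ∘L
    (f.range.subtypeL.codRestrict g.range fun y => by rw [hrange]; exact y.2), fun y => ?_⟩
  have h1 : ∀ z : g.range, g (e.symm z) = z := fun z => by
    conv_rhs => rw [← e.apply_symm_apply z]
    rfl
  exact h1 _

end RightInverse

/-! ### Shifted sequences and chains. -/

section Shift

variable {𝕂 B B' : Type*} [RCLike 𝕂] [NormedAddCommGroup B] [NormedSpace 𝕂 B]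
  [NormedAddCommGroup B'] [NormedSpace 𝕂 B']

/-- The sequence `0, …, 0, v₀, v₁, …` with `M` leading zeros. -/
def shift (𝕂 : Type*) {B : Type*} [RCLike 𝕂] [NormedAddCommGroup B] [NormedSpace 𝕂 B] (M : ℕ) :
    (ℕ → B) →L[𝕂] (ℕ → B) :=
  ContinuousLinearMap.pi fun i => if i < M then 0 else ContinuousLinearMap.proj (i - M)

theorem shift_of_lt {M i : ℕ} (h : i < M) (v : ℕ → B) : shift 𝕂 M v i = 0 := by
  simp [shift, h]

@[simp] theorem shift_add (M j : ℕ) (v : ℕ → B) : shift 𝕂 M v (M + j) = v j := by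
  simp [shift]

/-- The residual as a continuous linear mapping on sequences. -/
def residualL (𝕂 : Type*) {B B' : Type*} [RCLike 𝕂] [NormedAddCommGroup B] [NormedSpace 𝕂 B]
    [NormedAddCommGroup B'] [NormedSpace 𝕂 B'] (G : B → B') {k : ℕ} (zbar : Fin k → B) (s : ℕ) :
    (ℕ → B) →L[𝕂] B' :=
  ∑ t ∈ Finset.range (s + 1), linCoeff 𝕂 G zbar t ∘L ContinuousLinearMap.proj (s - t)

variable (G : B → B') {k : ℕ} (zbar : Fin k → B)

theorem residualL_apply (s : ℕ) (v : ℕ → B) : residualL 𝕂 G zbar s v = residual 𝕂 G zbar s v := by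
  rw [residual_apply]
  simp [residualL]

theorem mem_chains {i : ℕ} {v : ℕ → B} :
    v ∈ chains 𝕂 G zbar i ↔ ∀ s < i, residual 𝕂 G zbar s v = 0 := by
  simp only [chains, Submodule.mem_iInf, LinearMap.mem_ker]
  exact ⟨fun h s hs => h ⟨s, hs⟩, fun h s => h s s.2⟩

theorem chains_antitone {i j : ℕ} (h : i ≤ j) : chains 𝕂 G zbar j ≤ chains 𝕂 G zbar i :=
  fun _ hv => (mem_chains G zbar).2 fun s hs => (mem_chains G zbar).1 hv s (hs.trans_le h)

theorem residual_shift_one_succ (s : ℕ) (v : ℕ → B) :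
    residual 𝕂 G zbar (s + 1) (shift 𝕂 1 v) = residual 𝕂 G zbar s v := by
  rw [residual_apply, residual_apply, Finset.sum_range_succ]
  rw [Nat.sub_self, shift_of_lt Nat.one_pos, map_zero, add_zero]
  refine Finset.sum_congr rfl fun t ht => ?_
  have : s + 1 - t = 1 + (s - t) := by have := Finset.mem_range.1 ht; omega
  rw [this, shift_add]

theorem residual_shift_one_zero (v : ℕ → B) : residual 𝕂 G zbar 0 (shift 𝕂 1 v) = 0 := by
  simp [residual_apply, shift_of_lt]

theorem shift_one_tail {v : ℕ → B} (h : v 0 = 0) : shift 𝕂 1 (fun j => v (j + 1)) = v := by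
  ext i
  rcases i with _ | i
  · rw [shift_of_lt Nat.one_pos, h]
  · rw [add_comm i 1, shift_add, add_comm]

/-- This is the link between consecutive stages: a chain of length `i + 1` with leading entry zero
is a delayed chain of length `i`. -/
theorem shift_one_mem_chains {i : ℕ} {v : ℕ → B} :
    shift 𝕂 1 v ∈ chains 𝕂 G zbar (i + 1) ↔ v ∈ chains 𝕂 G zbar i := by
  simp only [mem_chains]
  refine ⟨fun h s hs => ?_, fun h s hs => ?_⟩
  · rw [← residual_shift_one_succ]; exact h _ (by omega)
  · rcases s with _ | s
    · exact residual_shift_one_zero G zbar v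
    · rw [residual_shift_one_succ]; exact h s (by omega)

end Shift

/-! ### The iteration `N_i`, `R_i` in terms of chains. -/

section Iteration

variable {𝕂 B B' : Type*} [RCLike 𝕂] [NormedAddCommGroup B] [NormedSpace 𝕂 B]
  [NormedAddCommGroup B'] [NormedSpace 𝕂 B'] {G : B → B'} {k : ℕ} {zbar : Fin k → B}

/-- The facts about `N_i` and `R₁ ⊕ ⋯ ⊕ R_i` that are propagated by the iteration. -/
structure StageData (𝕂 : Type*) {B B' : Type*} [RCLike 𝕂] [NormedAddCommGroup B]
    [NormedSpace 𝕂 B] [NormedAddCommGroup B'] [NormedSpace 𝕂 B'] (G : B → B') {k : ℕ}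
    (zbar : Fin k → B) (Rc : ℕ → Submodule 𝕂 B') (i : ℕ) : Prop where
  mem_N : ∀ n, n ∈ N 𝕂 G zbar Rc i ↔ ∃ v ∈ chains 𝕂 G zbar i, v 0 = n
  mem_Rsum : ∀ y, y ∈ Rsum 𝕂 G zbar Rc i ↔
    ∃ v ∈ chains 𝕂 G zbar i, v 0 = 0 ∧ residual 𝕂 G zbar i v = y
  isCompl : IsCompl (Rc i) (Rsum 𝕂 G zbar Rc i)
  isClosed_N : IsClosed (N 𝕂 G zbar Rc i : Set B)
  isClosed_Rc : IsClosed (Rc i : Set B')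
  isClosed_Rsum : IsClosed (Rsum 𝕂 G zbar Rc i : Set B')
  exists_chain : ∃ E : N 𝕂 G zbar Rc i →L[𝕂] (ℕ → B), ∀ n, E n ∈ chains 𝕂 G zbar i ∧ E n 0 = n
  exists_solution : ∃ D : Rsum 𝕂 G zbar Rc i →L[𝕂] (ℕ → B),
    ∀ y, D y ∈ chains 𝕂 G zbar i ∧ D y 0 = 0 ∧ residual 𝕂 G zbar i (D y) = y

/-- The normalization factor of `S_{i+1}`. -/
def normFactor (𝕂 : Type*) [RCLike 𝕂] (i : ℕ) : 𝕂 := ((2 * i).factorial : 𝕂) / (i.factorial : 𝕂)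

theorem normFactor_ne_zero (i : ℕ) : normFactor 𝕂 i ≠ 0 :=
  div_ne_zero (by exact_mod_cast (2 * i).factorial_ne_zero) (by exact_mod_cast i.factorial_ne_zero)

variable {Rc : ℕ → Submodule 𝕂 B'} {Nc : ℕ → Submodule 𝕂 B} {i : ℕ}

/-- Two chains with the same leading entry differ by one with leading entry zero. Its residual lies
in `R₁ ⊕ ⋯ ⊕ R_i` and is removed by the projection, so `opGraph` is single valued and the default
branches of `projAlong` and `opOn` do not occur. -/
theorem StageData.S_apply (h : StageData 𝕂 G zbar Rc i) {v : ℕ → B}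
    (hv : v ∈ chains 𝕂 G zbar i) (n : N 𝕂 G zbar Rc i) (hn : v 0 = n) :
    S 𝕂 G zbar Rc i n =
      normFactor 𝕂 i • (Rc i).projection _ h.isCompl (residual 𝕂 G zbar i v) := by
  set g := opGraph 𝕂 G zbar (Rsum 𝕂 G zbar Rc i) (Rc i) i with hg
  have hproj : projAlong (Rc i) (Rsum 𝕂 G zbar Rc i) = (Rc i).projection _ h.isCompl := by
    rw [projAlong, dif_pos h.isCompl]
  have hmem : ∀ w ∈ chains 𝕂 G zbar i, (w 0, normFactor 𝕂 i •
      (Rc i).projection _ h.isCompl (residual 𝕂 G zbar i w)) ∈ g := by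
    intro w hw
    refine ⟨w, hw, ?_⟩
    rw [hproj]
    rfl
  have hfun : ∀ x ∈ g, x.1 = 0 → x.2 = 0 := by
    rintro _ ⟨w, hw, rfl⟩ h0
    rw [hproj]
    have : (Rc i).projection _ h.isCompl (residual 𝕂 G zbar i w) = 0 :=
      (Submodule.projection_apply_eq_zero_iff _).2 ((h.mem_Rsum _).2 ⟨w, hw, h0, rfl⟩)
    change normFactor 𝕂 i • (Rc i).projection _ h.isCompl (residual 𝕂 G zbar i w) = 0
    rw [this, smul_zero]
  have hdom : N 𝕂 G zbar Rc i ≤ g.toLinearPMap.domain := by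
    intro x hx
    obtain ⟨w, hw, rfl⟩ := (h.mem_N x).1 hx
    exact ⟨_, hmem w hw, rfl⟩
  have hS : S 𝕂 G zbar Rc i = g.toLinearPMap.toFun ∘ₗ Submodule.inclusion hdom := by
    rw [S, opOn, dif_pos hdom]
  have h1 : ((n : B), S 𝕂 G zbar Rc i n) ∈ g := by
    rw [hS]
    exact Submodule.mem_graph_toLinearPMap hfun (Submodule.inclusion hdom n)
  have h2 := hmem v hv
  rw [hn] at h2
  have h3 := hfun _ (g.sub_mem h1 h2) (by simp)
  exact sub_eq_zero.1 h3

theorem StageData.zero (hRc : Rc 0 = ⊤) : StageData 𝕂 G zbar Rc 0 where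
  mem_N n := ⟨fun _ => ⟨fun _ => n, (mem_chains G zbar).2 fun s hs => by omega, rfl⟩,
    fun _ => Submodule.mem_top⟩
  mem_Rsum y := by
    refine ⟨fun h => ⟨0, zero_mem _, rfl, ?_⟩, ?_⟩
    · rw [map_zero]; exact ((Submodule.mem_bot 𝕂).1 h).symm
    · rintro ⟨v, -, hv, rfl⟩
      refine (Submodule.mem_bot 𝕂).2 ?_
      simp [residual_apply, hv]
  isCompl := by rw [hRc]; exact isCompl_top_bot
  isClosed_N := isClosed_univ
  isClosed_Rc := by rw [hRc]; exact isClosed_univ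
  isClosed_Rsum := isClosed_singleton
  exists_chain := ⟨ContinuousLinearMap.pi fun _ => (N 𝕂 G zbar Rc 0).subtypeL,
    fun n => ⟨(mem_chains G zbar).2 fun s hs => by omega, rfl⟩⟩
  exists_solution := ⟨0, fun y => ⟨zero_mem _, rfl, by
    rw [zero_apply, map_zero]
    exact ((Submodule.mem_bot 𝕂).1 y.2).symm⟩⟩

theorem mem_N_succ {n : B} : n ∈ N 𝕂 G zbar Rc (i + 1) ↔
    ∃ h : n ∈ N 𝕂 G zbar Rc i, S 𝕂 G zbar Rc i ⟨n, h⟩ = 0 := by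
  constructor
  · rintro ⟨x, hx, rfl⟩; exact ⟨x.2, hx⟩
  · rintro ⟨h, hS⟩; exact ⟨⟨n, h⟩, hS, rfl⟩

theorem Rsum_succ : Rsum 𝕂 G zbar Rc (i + 1) =
    Rsum 𝕂 G zbar Rc i ⊔ LinearMap.range (S 𝕂 G zbar Rc i) := rfl

theorem Rsum_eq_top_iff_surjective (j : ℕ) :
    Rsum 𝕂 G zbar Rc (j + 1) = ⊤ ↔ Function.Surjective (sumOp 𝕂 G zbar Rc j) := by
  have key : ∀ j y, y ∈ Rsum 𝕂 G zbar Rc (j + 1) ↔ ∃ n, sumOp 𝕂 G zbar Rc j n = y := by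
    intro j
    induction j with
    | zero =>
      intro y
      rw [Rsum_succ]
      change y ∈ ⊥ ⊔ _ ↔ _
      rw [bot_sup_eq]
      constructor
      · rintro ⟨n, rfl⟩
        refine ⟨fun i => ⟨n, ?_⟩, ?_⟩
        · have : (i : ℕ) = 0 := by omega
          rw [this]; exact n.2
        · simp [sumOp]
      · rintro ⟨n, rfl⟩
        exact ⟨n 0, by simp [sumOp]⟩
    | succ j ih =>
      intro y
      rw [Rsum_succ, Submodule.mem_sup]
      constructor
      · rintro ⟨a, ha, _, ⟨n, rfl⟩, rfl⟩
        obtain ⟨m, rfl⟩ := (ih a).1 ha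
        refine ⟨Fin.lastCases (motive := fun i => N 𝕂 G zbar Rc i) n m, ?_⟩
        rw [sumOp, Fin.sum_univ_castSucc]
        simp only [Fin.lastCases_castSucc, Fin.lastCases_last]
        rfl
      · rintro ⟨n, rfl⟩
        refine ⟨_, (ih _).2 ⟨fun i => n i.castSucc, rfl⟩, _, ⟨n (Fin.last _), rfl⟩, ?_⟩
        rw [sumOp]
        exact (Fin.sum_univ_castSucc (fun i => S 𝕂 G zbar Rc i (n i))).symm
  rw [Submodule.eq_top_iff']
  exact forall_congr' (key j)

theorem StageData.range_S_le (h : StageData 𝕂 G zbar Rc i) :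
    LinearMap.range (S 𝕂 G zbar Rc i) ≤ Rc i := by
  rintro _ ⟨n, rfl⟩
  obtain ⟨v, hv, hn⟩ := (h.mem_N n).1 n.2
  rw [h.S_apply hv n hn]
  exact Submodule.smul_mem _ _ (Submodule.projection_apply_mem _ _)

theorem StageData.mem_Rsum_succ (h : StageData 𝕂 G zbar Rc i) {y : B'} :
    y ∈ Rsum 𝕂 G zbar Rc (i + 1) ↔
      (Rc i).projection _ h.isCompl y ∈ LinearMap.range (S 𝕂 G zbar Rc i) := by
  constructor
  · intro hy
    obtain ⟨a, ha, b, hb, rfl⟩ := Submodule.mem_sup.1 hy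
    rw [map_add, (Submodule.projection_apply_eq_zero_iff h.isCompl).2 ha, zero_add,
      Submodule.projection_apply_of_mem_left _ (h.range_S_le hb)]
    exact hb
  · intro hy
    rw [← sub_add_cancel y ((Rc i).projection _ h.isCompl y)]
    exact Submodule.add_mem_sup (Submodule.sub_projection_mem _ _) hy

variable [CompleteSpace B']

/-- `S_{i+1}` as a continuous operator. -/
theorem StageData.exists_continuous (h : StageData 𝕂 G zbar Rc i) :
    ∃ f : N 𝕂 G zbar Rc i →L[𝕂] B', (f : N 𝕂 G zbar Rc i →ₗ[𝕂] B') = S 𝕂 G zbar Rc i := by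
  obtain ⟨E, hE⟩ := h.exists_chain
  have ht := Submodule.IsCompl.isTopCompl_of_isClosed h.isCompl h.isClosed_Rc h.isClosed_Rsum
  refine ⟨normFactor 𝕂 i • ((Rc i).projectionL _ ht ∘L residualL 𝕂 G zbar i ∘L E), ?_⟩
  ext n
  rw [h.S_apply (hE n).1 n (hE n).2]
  simp [residualL_apply]

variable [CompleteSpace B]

/-- Every element of `R₁ ⊕ ⋯ ⊕ R_{i+1}` is the residual of order `i` of a formal perturbation that
is annihilated in all lower orders, and this perturbation can be chosen continuously and linearly. -/
theorem StageData.exists_chain_residual (h : StageData 𝕂 G zbar Rc i)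
    (hd : IsDecomposition 𝕂 G zbar Nc Rc) (hi : i ≤ k) :
    ∃ A : Rsum 𝕂 G zbar Rc (i + 1) →L[𝕂] (ℕ → B),
      ∀ y, A y ∈ chains 𝕂 G zbar i ∧ residual 𝕂 G zbar i (A y) = y := by
  obtain ⟨E, hE⟩ := h.exists_chain
  obtain ⟨D, hD⟩ := h.exists_solution
  obtain ⟨f, hf⟩ := h.exists_continuous
  have ht := Submodule.IsCompl.isTopCompl_of_isClosed h.isCompl h.isClosed_Rc h.isClosed_Rsum
  have := h.isClosed_N.completeSpace_coe
  have hrange : f.range = LinearMap.range (S 𝕂 G zbar Rc i) := by rw [← hf]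
  have hfS : ∀ n, f n = S 𝕂 G zbar Rc i n := fun n => by rw [← hf]; rfl
  obtain ⟨m, hm⟩ := exists_rightInverse_on_range f (by rw [hrange]; exact hd.R_closed i hi)
    ((Nc (i + 1)).comap (N 𝕂 G zbar Rc i).subtype)
    ((hd.Nc_closed i hi).preimage continuous_subtype_val)
    (by
      rw [Submodule.disjoint_def]
      intro x hx hx'
      have := Submodule.disjoint_def.1 (hd.Nc_disjoint i hi) x hx
        (mem_N_succ.2 ⟨x.2, by rw [← hfS]; exact hx'⟩)
      exact Subtype.ext this)
    (by
      refine eq_top_iff.2 fun x _ => ?_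
      have hx : (x : B) ∈ Nc (i + 1) ⊔ N 𝕂 G zbar Rc (i + 1) := by
        rw [hd.Nc_sup i hi]; exact x.2
      obtain ⟨c, hc, n, hn, hcn⟩ := Submodule.mem_sup.1 hx
      obtain ⟨hn1, hn2⟩ := mem_N_succ.1 hn
      have hc1 : c ∈ N 𝕂 G zbar Rc i := by
        rw [← hd.Nc_sup i hi]; exact Submodule.mem_sup_left hc
      refine Submodule.mem_sup.2 ⟨⟨c, hc1⟩, hc, ⟨n, hn1⟩, ?_, Subtype.ext hcn⟩
      exact (hfS _).trans hn2)
  set Q : Rsum 𝕂 G zbar Rc (i + 1) →L[𝕂] f.range :=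
    ((Rc i).projectionL _ ht ∘L (Rsum 𝕂 G zbar Rc (i + 1)).subtypeL).codRestrict f.range
      (fun y => by rw [hrange]; exact h.mem_Rsum_succ.1 y.2) with hQ
  -- `S_{i+1}` carries the factor `normFactor 𝕂 i`, so the same factor here makes the residual of `V
  -- y` agree with `y` modulo `R₁ ⊕ ⋯ ⊕ R_i`.
  set V : Rsum 𝕂 G zbar Rc (i + 1) →L[𝕂] (ℕ → B) := normFactor 𝕂 i • (E ∘L m ∘L Q) with hV
  have hVmem : ∀ y, V y ∈ chains 𝕂 G zbar i := fun y => Submodule.smul_mem _ _ (hE _).1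
  have hVproj : ∀ y : Rsum 𝕂 G zbar Rc (i + 1), (y : B') - residual 𝕂 G zbar i (V y) ∈
      Rsum 𝕂 G zbar Rc i := by
    intro y
    rw [← Submodule.projection_apply_eq_zero_iff h.isCompl, map_sub, sub_eq_zero]
    have h1 := h.S_apply (hE (m (Q y))).1 _ (hE (m (Q y))).2
    rw [← hfS, hm] at h1
    rw [hV, smul_apply, map_smul, map_smul]
    exact h1
  -- The remaining discrepancy lies in `R₁ ⊕ ⋯ ⊕ R_i`, where `D` solves exactly.
  refine ⟨V + D ∘L (((Rsum 𝕂 G zbar Rc (i + 1)).subtypeL -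
    residualL 𝕂 G zbar i ∘L V).codRestrict (Rsum 𝕂 G zbar Rc i) fun y => by
      simpa [residualL_apply] using hVproj y), fun y => ⟨?_, ?_⟩⟩
  · exact Submodule.add_mem _ (hVmem y) (hD _).1
  · rw [add_apply, map_add, ContinuousLinearMap.comp_apply, (hD _).2.2]
    simp [residualL_apply]

theorem StageData.succ (h : StageData 𝕂 G zbar Rc i)
    (hd : IsDecomposition 𝕂 G zbar Nc Rc) (hi : i ≤ k) : StageData 𝕂 G zbar Rc (i + 1) := by
  obtain ⟨A, hA⟩ := h.exists_chain_residual hd hi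
  obtain ⟨E, hE⟩ := h.exists_chain
  obtain ⟨D, hD⟩ := h.exists_solution
  obtain ⟨f, hf⟩ := h.exists_continuous
  have hfS : ∀ n, f n = S 𝕂 G zbar Rc i n := fun n => by rw [← hf]; rfl
  have ht := Submodule.IsCompl.isTopCompl_of_isClosed h.isCompl h.isClosed_Rc h.isClosed_Rsum
  have hle : N 𝕂 G zbar Rc (i + 1) ≤ N 𝕂 G zbar Rc i := fun n hn => (mem_N_succ.1 hn).1
  set ι : N 𝕂 G zbar Rc (i + 1) →L[𝕂] N 𝕂 G zbar Rc i :=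
    (N 𝕂 G zbar Rc (i + 1)).subtypeL.codRestrict _ fun n => hle n.2 with hι
  have hres : ∀ n : N 𝕂 G zbar Rc (i + 1), residual 𝕂 G zbar i (E (ι n)) ∈
      Rsum 𝕂 G zbar Rc i := by
    intro n
    obtain ⟨hn, hS⟩ := mem_N_succ.1 n.2
    have h1 := h.S_apply (hE (ι n)).1 _ (hE (ι n)).2
    rw [show S 𝕂 G zbar Rc i (ι n) = 0 from hS] at h1
    exact (Submodule.projection_apply_eq_zero_iff _).1
      ((smul_eq_zero.1 h1.symm).resolve_left (normFactor_ne_zero i))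
  -- For `n` in the kernel of `S_{i+1}` the residual of order `i` of its chain lies in `R₁ ⊕ ⋯ ⊕
  -- R_i`. Subtracting the solution given by `D` removes it without changing the leading entry, so
  -- the chain becomes longer by one.
  have hchain : ∃ E' : N 𝕂 G zbar Rc (i + 1) →L[𝕂] (ℕ → B),
      ∀ n, E' n ∈ chains 𝕂 G zbar (i + 1) ∧ E' n 0 = n := by
    refine ⟨E ∘L ι - D ∘L ((residualL 𝕂 G zbar i ∘L E ∘L ι).codRestrict (Rsum 𝕂 G zbar Rc i)
      fun n => by simpa [residualL_apply] using hres n), fun n => ⟨?_, ?_⟩⟩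
    · refine (mem_chains G zbar).2 fun s hs => ?_
      rw [sub_apply, map_sub, ContinuousLinearMap.comp_apply, ContinuousLinearMap.comp_apply]
      rcases Nat.lt_succ_iff_lt_or_eq.1 hs with hs | rfl
      · rw [(mem_chains G zbar).1 (hE _).1 s hs, (mem_chains G zbar).1 (hD _).1 s hs, sub_zero]
      · rw [(hD _).2.2]
        simp [residualL_apply]
    · rw [sub_apply, Pi.sub_apply, ContinuousLinearMap.comp_apply, ContinuousLinearMap.comp_apply,
        (hE _).2, (hD _).2.1, sub_zero]
      rfl
  refine ⟨fun n => ⟨fun hn => ?_, ?_⟩, fun y => ⟨fun hy => ?_, ?_⟩, ?_, ?_, hd.Rc_closed i hi, ?_,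
    hchain, ?_⟩
  · obtain ⟨E', hE'⟩ := hchain
    exact ⟨E' ⟨n, hn⟩, (hE' _).1, (hE' _).2⟩
  · rintro ⟨v, hv, rfl⟩
    have hv' := chains_antitone G zbar (Nat.le_succ i) hv
    have hn : v 0 ∈ N 𝕂 G zbar Rc i := (h.mem_N _).2 ⟨v, hv', rfl⟩
    refine mem_N_succ.2 ⟨hn, ?_⟩
    rw [h.S_apply hv' ⟨v 0, hn⟩ rfl, (mem_chains G zbar).1 hv i (Nat.lt_succ_self i), map_zero,
      smul_zero]
  · refine ⟨shift 𝕂 1 (A ⟨y, hy⟩), (shift_one_mem_chains G zbar).2 (hA _).1,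
      shift_of_lt Nat.one_pos _, ?_⟩
    rw [residual_shift_one_succ, (hA _).2]
  -- Dropping the leading zero turns `v` into a chain of length `i` whose residual of order `i`
  -- projects to a multiple of `S_{i+1}` at its leading entry.
  · rintro ⟨v, hv, h0, rfl⟩
    rw [← shift_one_tail (𝕂 := 𝕂) h0] at hv ⊢
    set u : ℕ → B := fun j => v (j + 1)
    have hu := (shift_one_mem_chains G zbar).1 hv
    rw [residual_shift_one_succ, h.mem_Rsum_succ]
    have hn : u 0 ∈ N 𝕂 G zbar Rc i := (h.mem_N _).2 ⟨u, hu, rfl⟩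
    have h1 := h.S_apply hu ⟨u 0, hn⟩ rfl
    refine ⟨(normFactor 𝕂 i)⁻¹ • ⟨u 0, hn⟩, ?_⟩
    rw [map_smul, h1, smul_smul, inv_mul_cancel₀ (normFactor_ne_zero i), one_smul]
  · constructor
    · rw [Submodule.disjoint_def]
      intro y hy hy'
      have hy1 : y ∈ Rc i := by rw [← hd.R_sup i hi]; exact Submodule.mem_sup_right hy
      rw [h.mem_Rsum_succ, Submodule.projection_apply_of_mem_left _ hy1] at hy'
      exact Submodule.disjoint_def.1 (hd.R_disjoint i hi) y hy' hy
    · rw [codisjoint_iff, Rsum_succ, sup_comm, sup_assoc, hd.R_sup i hi, sup_comm]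
      exact h.isCompl.sup_eq_top
  · have h1 : (N 𝕂 G zbar Rc (i + 1) : Set B) = Subtype.val '' (f ⁻¹' {0}) := by
      ext n
      simp only [SetLike.mem_coe, mem_N_succ, ← hfS]
      constructor
      · rintro ⟨hn, h0⟩; exact ⟨⟨n, hn⟩, h0, rfl⟩
      · rintro ⟨x, hx, rfl⟩; exact ⟨x.2, hx⟩
    rw [h1]
    exact h.isClosed_N.isClosedEmbedding_subtypeVal.isClosedMap _
      (isClosed_singleton.preimage f.continuous)
  -- A sum of closed subspaces need not be closed; here it is the preimage of the closed range of
  -- `S_{i+1}` under a continuous projection.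
  · have h1 : (Rsum 𝕂 G zbar Rc (i + 1) : Set B') = ((Rc i).projectionL _ ht) ⁻¹'
        (LinearMap.range (S 𝕂 G zbar Rc i) : Set B') := by
      ext y
      simp only [SetLike.mem_coe, h.mem_Rsum_succ, Set.mem_preimage, Submodule.projectionL_apply]
      rfl
    rw [h1]
    exact (hd.R_closed i hi).preimage (ContinuousLinearMap.continuous _)
  · refine ⟨shift 𝕂 1 ∘L A, fun y => ⟨(shift_one_mem_chains G zbar).2 (hA y).1,
      shift_of_lt (𝕂 := 𝕂) Nat.one_pos _, ?_⟩⟩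
    rw [ContinuousLinearMap.comp_apply, residual_shift_one_succ, (hA y).2]

theorem stageData (hd : IsDecomposition 𝕂 G zbar Nc Rc) :
    ∀ i ≤ k + 1, StageData 𝕂 G zbar Rc i
  | 0, _ => StageData.zero hd.Rc_zero
  | i + 1, h => (stageData hd i (by omega)).succ hd (by omega)

end Iteration

/-! ### Division of analytic functions by powers of `ε`, and the implicit function theorem. -/

section Division

variable {𝕂 E F : Type*} [RCLike 𝕂] [NormedAddCommGroup E] [NormedSpace 𝕂 E]
  [NormedAddCommGroup F] [NormedSpace 𝕂 F]

/-- The projection `(ε, h) ↦ (0, h)`. -/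
def dropFst (𝕂 E : Type*) [RCLike 𝕂] [NormedAddCommGroup E] [NormedSpace 𝕂 E] :
    𝕂 × E →L[𝕂] 𝕂 × E :=
  ContinuousLinearMap.inr 𝕂 𝕂 E ∘L ContinuousLinearMap.snd 𝕂 𝕂 E

theorem norm_dropFst_le : ‖dropFst 𝕂 E‖ ≤ 1 :=
  ContinuousLinearMap.opNorm_le_bound _ zero_le_one fun x => by
    simpa [dropFst] using norm_snd_le x

/-- The multilinear mapping `(x₀, …, x_{m-1}) ↦ f (x₀, …, x_{j-1}, (1, 0), πx_j, …, πx_{m-1})`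
with `π (ε, h) = (0, h)`. -/
def insertFst {m : ℕ} (f : ContinuousMultilinearMap 𝕂 (fun _ : Fin (m + 1) => 𝕂 × E) F)
    (j : Fin (m + 1)) : ContinuousMultilinearMap 𝕂 (fun _ : Fin m => 𝕂 × E) F :=
  (f.compContinuousLinearMap (fun i => if i ≤ j then ContinuousLinearMap.id 𝕂 (𝕂 × E)
    else dropFst 𝕂 E)).curryMid j ((1 : 𝕂), (0 : E))

theorem norm_insertFst_le {m : ℕ}
    (f : ContinuousMultilinearMap 𝕂 (fun _ : Fin (m + 1) => 𝕂 × E) F) (j : Fin (m + 1)) :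
    ‖insertFst f j‖ ≤ ‖f‖ := by
  refine (ContinuousLinearMap.le_opNorm _ _).trans ?_
  rw [ContinuousMultilinearMap.norm_curryMid]
  have h1 : ‖((1 : 𝕂), (0 : E))‖ = 1 := by simp [Prod.norm_def]
  rw [h1, mul_one]
  refine (ContinuousMultilinearMap.norm_compContinuousLinearMap_le _ _).trans ?_
  refine mul_le_of_le_one_right (norm_nonneg _) (Finset.prod_le_one (fun _ _ => norm_nonneg _) ?_)
  intro i _
  split_ifs
  · exact ContinuousLinearMap.norm_id_le
  · exact norm_dropFst_le

/-- The two arguments on the right differ only in the slot `j`, and there by `x - πx = x.1 • (1,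
0)`. -/
theorem smul_insertFst_apply {m : ℕ}
    (f : ContinuousMultilinearMap 𝕂 (fun _ : Fin (m + 1) => 𝕂 × E) F) (j : Fin (m + 1))
    (x : 𝕂 × E) :
    x.1 • insertFst f j (fun _ => x) =
      f (fun i => if (i : ℕ) < j + 1 then x else dropFst 𝕂 E x) -
        f (fun i => if (i : ℕ) < j then x else dropFst 𝕂 E x) := by
  set w : Fin (m + 1) → 𝕂 × E := fun i => if (i : ℕ) < j then x else dropFst 𝕂 E x with hw
  have h1 : insertFst f j (fun _ => x) = f (Function.update w j ((1 : 𝕂), (0 : E))) := by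
    rw [insertFst, ContinuousMultilinearMap.curryMid_apply,
      ContinuousMultilinearMap.compContinuousLinearMap_apply]
    congr 1
    ext1 i
    refine Fin.succAboveCases j ?_ (fun i => ?_) i
    · simp
    · rw [Fin.insertNth_apply_succAbove, Function.update_of_ne (Fin.succAbove_ne j i)]
      by_cases hij : j.succAbove i < j
      · rw [if_pos hij.le, hw]; exact (if_pos (Fin.lt_def.1 hij)).symm
      · have hne := Fin.succAbove_ne j i
        rw [if_neg (by
          intro hle; exact hij (lt_of_le_of_ne hle hne)), hw]
        exact (if_neg fun h => hij (Fin.lt_def.2 h)).symm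
  have h2 : (fun i : Fin (m + 1) => if (i : ℕ) < j + 1 then x else dropFst 𝕂 E x) =
      Function.update w j x := by
    ext1 i
    by_cases hij : i = j
    · subst hij; simp
    · rw [Function.update_of_ne hij]
      simp only [hw]
      have : (i : ℕ) ≠ j := fun h => hij (Fin.ext h)
      by_cases h : (i : ℕ) < j
      · rw [if_pos (by omega), if_pos h]
      · rw [if_neg (by omega), if_neg h]
  have h3 : w = Function.update w j (dropFst 𝕂 E x) := by
    rw [eq_comm, Function.update_eq_self_iff, hw]; simp
  rw [h1, h2]
  conv_rhs => rw [h3]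
  rw [Function.update_idem, ← ContinuousMultilinearMap.map_update_smul,
    ← ContinuousMultilinearMap.map_update_sub]
  congr 2
  ext <;> simp [dropFst]

/-- The power series of `f (ε, h) / ε` if `f` has the power series `p` and vanishes for `ε = 0`. -/
def divFst (p : FormalMultilinearSeries 𝕂 (𝕂 × E) F) : FormalMultilinearSeries 𝕂 (𝕂 × E) F :=
  fun m => ∑ j : Fin (m + 1), insertFst (p (m + 1)) j

/-- The differences over `j` telescope. -/
theorem smul_divFst_apply (p : FormalMultilinearSeries 𝕂 (𝕂 × E) F) (m : ℕ) (x : 𝕂 × E) :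
    x.1 • divFst p m (fun _ => x) =
      p (m + 1) (fun _ => x) - p (m + 1) (fun _ => dropFst 𝕂 E x) := by
  rw [divFst, sum_apply, Finset.smul_sum]
  simp only [smul_insertFst_apply]
  rw [Fin.sum_univ_eq_sum_range (fun j => p (m + 1) (fun i : Fin (m + 1) =>
    if (i : ℕ) < j + 1 then x else dropFst 𝕂 E x) - p (m + 1) (fun i : Fin (m + 1) =>
    if (i : ℕ) < j then x else dropFst 𝕂 E x)), Finset.sum_range_sub (fun j => p (m + 1)
    (fun i : Fin (m + 1) => if (i : ℕ) < j then x else dropFst 𝕂 E x))]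
  congr 2
  · ext1 i; rw [if_pos i.2]

theorem radius_divFst_pos {p : FormalMultilinearSeries 𝕂 (𝕂 × E) F} (hp : 0 < p.radius) :
    0 < (divFst p).radius := by
  obtain ⟨C, r, hC, hr, h⟩ := p.le_mul_pow_of_radius_pos hp
  -- Here `r` is a growth rate, `‖p m‖ ≤ C r^m`. The `m + 1` summands of `divFst p m` cost a factor
  -- `m + 1 ≤ 2^m`, absorbed by the additional `2`.
  obtain ⟨ρ, hρ⟩ : ∃ ρ : NNReal, (ρ : ℝ) = (2 * r)⁻¹ :=
    ⟨(2 * r)⁻¹.toNNReal, Real.coe_toNNReal _ (by positivity)⟩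
  have hb : ∀ m, ‖divFst p m‖ * (ρ : ℝ) ^ m ≤ C * r := by
    intro m
    have h1 : ‖divFst p m‖ ≤ (m + 1) * (C * r ^ (m + 1)) := by
      refine (norm_sum_le _ _).trans ?_
      refine (Finset.sum_le_sum fun j _ => (norm_insertFst_le (p (m + 1)) j).trans (h _)).trans ?_
      simp
    have h2 : ((m : ℝ) + 1) ≤ 2 ^ m := by exact_mod_cast Nat.lt_two_pow_self
    rw [hρ]
    calc ‖divFst p m‖ * (2 * r)⁻¹ ^ m ≤ ((m + 1) * (C * r ^ (m + 1))) * (2 * r)⁻¹ ^ m := by gcongr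
      _ = ((m + 1) / 2 ^ m) * (C * r) := by
        rw [inv_pow, mul_pow, pow_succ]; field_simp
      _ ≤ 1 * (C * r) := by
        gcongr; exact (div_le_one (by positivity)).2 h2
      _ = C * r := one_mul _
  refine lt_of_lt_of_le ?_ ((divFst p).le_radius_of_bound _ hb)
  rw [ENNReal.coe_pos, ← NNReal.coe_pos, hρ]
  positivity

theorem exists_analyticAt_smul [CompleteSpace F] {f : 𝕂 × E → F} {y₀ : E}
    (hf : AnalyticAt 𝕂 f (0, y₀)) (h0 : ∀ᶠ y in 𝓝 y₀, f (0, y) = 0) :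
    ∃ g : 𝕂 × E → F, AnalyticAt 𝕂 g (0, y₀) ∧ ∀ᶠ p in 𝓝 ((0 : 𝕂), y₀), f p = p.1 • g p := by
  obtain ⟨p, hp⟩ := hf
  have hq := (divFst p).hasFPowerSeriesOnBall (radius_divFst_pos hp.radius_pos)
  have hq' : HasFPowerSeriesAt (divFst p).sum (divFst p) (0 : 𝕂 × E) := hq.hasFPowerSeriesAt
  have hsub : Tendsto (fun z : 𝕂 × E => z - (0, y₀)) (𝓝 (0, y₀)) (𝓝 0) := by
    have : Continuous fun z : 𝕂 × E => z - (0, y₀) := by fun_prop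
    simpa using this.tendsto (0, y₀)
  refine ⟨fun z => (divFst p).sum (z - (0, y₀)), ?_, ?_⟩
  · refine AnalyticAt.fun_comp (g := (divFst p).sum) ?_ (by fun_prop)
    rw [sub_self]
    exact ⟨_, hq'⟩
  have e1 := hsub.eventually hp.eventually_hasSum
  have hd : Tendsto (fun z : 𝕂 × E => dropFst 𝕂 E (z - (0, y₀))) (𝓝 (0, y₀)) (𝓝 0) := by
    have := ((dropFst 𝕂 E).continuous.tendsto 0).comp hsub
    rwa [map_zero] at this
  have e2 := hd.eventually hp.eventually_hasSum
  have e3 := hsub.eventually hq'.eventually_hasSum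
  have e4 : ∀ᶠ z : 𝕂 × E in 𝓝 (0, y₀), f (0, z.2) = 0 :=
    (continuous_snd.tendsto ((0 : 𝕂), y₀)).eventually h0
  filter_upwards [e1, e2, e3, e4] with z h1 h2 h3 h4
  have hz : (0, y₀) + dropFst 𝕂 E (z - (0, y₀)) = (0, z.2) := by
    ext <;> simp [dropFst]
  -- The series at the projected point sums to `f (0, z.2) = 0`; subtracting it termwise leaves `ε`
  -- times the series `divFst p`.
  rw [hz, h4] at h2
  have h5 := (h1.sub h2)
  rw [sub_zero, ← hasSum_nat_add_iff' 1] at h5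
  have h6 := h3.const_smul (z - (0, y₀)).1
  simp only [smul_divFst_apply] at h6
  have h7 := h5.unique h6
  simp only [Finset.range_one, Finset.sum_singleton] at h7
  have h8 : (p 0 fun _ => z - (0, y₀)) - (p 0 fun _ => dropFst 𝕂 E (z - (0, y₀))) = 0 := by
    rw [sub_eq_zero]; congr 1; ext1 i; exact i.elim0
  rw [h8, sub_zero] at h7
  simpa using h7

open Asymptotics in
theorem eventually_eval_zero [CompleteSpace F] (M : ℕ) {f : 𝕂 × E → F} {y₀ : E} {c : E → F}
    (hf : AnalyticAt 𝕂 f (0, y₀))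
    (h0 : ∀ᶠ y in 𝓝 y₀, (fun ε => f (ε, y) - ε ^ M • c y) =O[𝓝[≠] 0] fun ε : 𝕂 => ε ^ (M + 1)) :
    ∀ᶠ y in 𝓝 y₀, f (0, y) = (0 : 𝕂) ^ M • c y := by
  filter_upwards [h0, ((Continuous.prodMk_right (0 : 𝕂)).tendsto y₀).eventually hf.eventually_analyticAt] with y hy hay
  have t1 : Tendsto (fun ε : 𝕂 => f (ε, y)) (𝓝[≠] 0) (𝓝 (f (0, y))) :=
    (hay.continuousAt.tendsto.comp ((Continuous.prodMk_left y).tendsto 0)).mono_left nhdsWithin_le_nhds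
  have t2 : Tendsto (fun ε : 𝕂 => ε ^ (M + 1)) (𝓝[≠] 0) (𝓝 0) := by
    have : Continuous fun ε : 𝕂 => ε ^ (M + 1) := by fun_prop
    simpa using (this.tendsto 0).mono_left (nhdsWithin_le_nhds (s := {0}ᶜ))
  have t3 : Tendsto (fun ε : 𝕂 => ε ^ M • c y) (𝓝[≠] 0) (𝓝 ((0 : 𝕂) ^ M • c y)) := by
    have : Continuous fun ε : 𝕂 => ε ^ M • c y := by fun_prop
    exact (this.tendsto 0).mono_left nhdsWithin_le_nhds
  exact sub_eq_zero.1 (tendsto_nhds_unique (t1.sub t3) (hy.trans_tendsto t2))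

-- One factor `ε` is split off at a time. The expansion is required for each fixed `y` only, without
-- uniformity, since analyticity in both variables is known beforehand.
open Asymptotics in
theorem exists_analyticAt_pow_smul [CompleteSpace F] (M : ℕ) {f : 𝕂 × E → F} {y₀ : E} {c : E → F}
    (hf : AnalyticAt 𝕂 f (0, y₀))
    (h0 : ∀ᶠ y in 𝓝 y₀, (fun ε => f (ε, y) - ε ^ M • c y) =O[𝓝[≠] 0] fun ε : 𝕂 => ε ^ (M + 1)) :
    ∃ g : 𝕂 × E → F, AnalyticAt 𝕂 g (0, y₀) ∧
      (∀ᶠ p in 𝓝 ((0 : 𝕂), y₀), f p = p.1 ^ M • g p) ∧ ∀ᶠ y in 𝓝 y₀, g (0, y) = c y := by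
  have hι : ∀ y : E, Tendsto (fun ε : 𝕂 => (ε, y)) (𝓝 0) (𝓝 (0, y)) := fun y =>
    (Continuous.prodMk_left y).tendsto 0
  have hι' : Tendsto (fun y : E => ((0 : 𝕂), y)) (𝓝 y₀) (𝓝 (0, y₀)) :=
    (Continuous.prodMk_right (0 : 𝕂)).tendsto y₀
  induction M generalizing f with
  | zero => exact ⟨f, hf, by simp, by simpa using eventually_eval_zero 0 hf h0⟩
  | succ M ih =>
    obtain ⟨g, hg, hfg⟩ := exists_analyticAt_smul hf (by simpa using eventually_eval_zero (M + 1) hf h0)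
    have hO : ∀ᶠ y in 𝓝 y₀, (fun ε => g (ε, y) - ε ^ M • c y) =O[𝓝[≠] 0]
        fun ε : 𝕂 => ε ^ (M + 1) := by
      filter_upwards [h0, hι'.eventually hfg.eventually_nhds] with y hy hy'
      have h1 := (isBigO_refl (fun ε : 𝕂 => ε⁻¹) (𝓝[≠] 0)).smul hy
      refine h1.congr' ?_ ?_
      · filter_upwards [self_mem_nhdsWithin, nhdsWithin_le_nhds ((hι y).eventually hy')]
          with ε (hε : ε ≠ 0) hf
        rw [hf, smul_sub, smul_smul, smul_smul, inv_mul_cancel₀ hε, one_smul, pow_succ',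
          inv_mul_cancel_left₀ hε]
      · filter_upwards [self_mem_nhdsWithin] with ε (hε : ε ≠ 0)
        rw [smul_eq_mul, pow_succ', inv_mul_cancel_left₀ hε]
    obtain ⟨g', hg', hgg', hc⟩ := ih hg hO
    refine ⟨g', hg', ?_, hc⟩
    filter_upwards [hfg, hgg'] with z h1 h2
    rw [h1, h2, smul_smul, pow_succ']

open scoped ContDiff in
theorem exists_analyticAt_zero [CompleteSpace E] {g : 𝕂 × E → E} {y₀ : E}
    (hg : AnalyticAt 𝕂 g (0, y₀)) (h0 : ∀ᶠ y in 𝓝 y₀, g (0, y) = y - y₀) :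
    ∃ ψ : 𝕂 → E, AnalyticAt 𝕂 ψ 0 ∧ ψ 0 = y₀ ∧ ∀ᶠ ε in 𝓝 (0 : 𝕂), g (ε, ψ ε) = 0 := by
  have hc : ContDiffAt 𝕂 ω g (0, y₀) := hg.contDiffAt
  -- The partial derivative in `y` is the identity, so the implicit function theorem applies;
  -- smoothness class `ω` makes its solution analytic.
  have hd : fderiv 𝕂 g (0, y₀) ∘L .inr 𝕂 𝕂 E = ContinuousLinearMap.id 𝕂 E := by
    have h1 : HasFDerivAt (fun y : E => g (0, y)) (fderiv 𝕂 g (0, y₀) ∘L .inr 𝕂 𝕂 E) y₀ :=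
      HasFDerivAt.comp (g := g) y₀ hg.differentiableAt.hasFDerivAt (hasFDerivAt_prodMk_right 0 y₀)
    have h2 : HasFDerivAt (fun y : E => g (0, y)) (ContinuousLinearMap.id 𝕂 E) y₀ :=
      ((hasFDerivAt_id y₀).sub_const y₀).congr_of_eventuallyEq h0
    exact h1.unique h2
  have hinv : (fderiv 𝕂 g ((0 : 𝕂), y₀) ∘L .inr 𝕂 𝕂 E).IsInvertible := by
    rw [hd]; exact ⟨ContinuousLinearEquiv.refl 𝕂 E, rfl⟩
  have hω : (ω : WithTop ℕ∞) ≠ 0 := by simp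
  have hz : g (0, y₀) = 0 := by rw [h0.self_of_nhds, sub_self]
  refine ⟨hc.implicitFunction hω hinv, (hc.contDiffAt_implicitFunction hω hinv).analyticAt,
    hc.implicitFunction_apply_self hω hinv, ?_⟩
  filter_upwards [hc.eventually_apply_implicitFunction hω hinv] with ε hε
  rw [hε, hz]

end Division

/-! ### Lifting approximate solutions to analytic ones. -/

section Lift

open Asymptotics

variable {𝕂 B B' : Type*} [RCLike 𝕂] [NormedAddCommGroup B] [NormedSpace 𝕂 B]
  [NormedAddCommGroup B'] [NormedSpace 𝕂 B'] {G : B → B'} {k : ℕ} {zbar : Fin k → B}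

/-- Adding, from the index `M ≥ k` on, a perturbation to a sequence with leading coefficients `z̄`
changes the coefficients of order `M + 1, …, M + 1 + k` of `G` by the residuals. -/
theorem arcCoeff_add_shift [CompleteSpace B'] (hG : AnalyticAt 𝕂 G 0) {a : ℕ → B} {M : ℕ}
    (hM : k ≤ M) (ha : ∀ i < k, a i = normalize 𝕂 zbar i) (v : ℕ → B) {s : ℕ} (hs : s ≤ k) :
    arcCoeff 𝕂 G (a + shift 𝕂 M v) (M + 1 + s) =
      arcCoeff 𝕂 G a (M + 1 + s) + residual 𝕂 G zbar s v := by
  rw [← sub_eq_iff_eq_add', arcCoeff_sub_eq_residual hG zbar hM ha (fun i hi => by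
    rw [Pi.add_apply, shift_of_lt hi, add_zero]) hs]
  congr 1
  ext j
  simp

theorem arcCoeff_add_shift_of_le {a : ℕ → B} {M m : ℕ} (v : ℕ → B) (hm : m ≤ M) :
    arcCoeff 𝕂 G (a + shift 𝕂 M v) m = arcCoeff 𝕂 G a m :=
  arcCoeff_congr fun i hi => by rw [Pi.add_apply, shift_of_lt (by omega), add_zero]

/-- An approximate solution of order `M + k` is the jet of order `M` of an exact solution, if the
linearization along `z̄` has a right inverse with loss of order `k`. -/
theorem exists_analytic_solution [CompleteSpace B] [CompleteSpace B'] (hG : AnalyticAt 𝕂 G 0)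
    (A : B' →L[𝕂] (ℕ → B))
    (hA : ∀ y, A y ∈ chains 𝕂 G zbar k ∧ residual 𝕂 G zbar k (A y) = y)
    {a : ℕ → B} {M : ℕ} (hM : k ≤ M) (ha : ∀ i < k, a i = normalize 𝕂 zbar i)
    (hsol : ∀ m ≤ M + k, arcCoeff 𝕂 G a m = 0) :
    ∃ γ : 𝕂 → B, AnalyticAt 𝕂 γ 0 ∧ γ 0 = 0 ∧ (∀ᶠ ε in 𝓝 (0 : 𝕂), G (γ ε) = 0) ∧
      ∀ i < M, iteratedDeriv (i + 1) γ 0 = ((i + 1).factorial : 𝕂) • a i := by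
  set n := M + 1 + k with hn
  -- The correction is parametrized by the value `y` that it adds to the coefficient of order `n`,
  -- the first order not yet solved.
  set Γ : 𝕂 × B' → B := fun p => arc (a + shift 𝕂 M (A p.2)) n p.1 with hΓ
  have hΓa : ∀ p, AnalyticAt 𝕂 Γ p := by
    intro p
    have h : ∀ i, AnalyticAt 𝕂 (fun p : 𝕂 × B' => p.1 ^ (i + 1) • (a i + shift 𝕂 M (A p.2) i)) p := by
      intro i
      have h1 : AnalyticAt 𝕂 (fun p : 𝕂 × B' => shift 𝕂 M (A p.2) i) p :=
        ((ContinuousLinearMap.proj (R := 𝕂) (φ := fun _ : ℕ => B) i ∘L shift 𝕂 M ∘L A ∘L ContinuousLinearMap.snd 𝕂 𝕂 B' :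
          𝕂 × B' →L[𝕂] B)).analyticAt p
      exact ((analyticAt_fst).pow _).smul (analyticAt_const.add h1)
    simpa only [hΓ, arc, Pi.add_apply] using Finset.analyticAt_fun_sum _ fun i _ => h i
  -- This value cancels the coefficient of order `n`; it is the starting point `ψ 0` of the implicit
  -- function.
  set y₀ : B' := -arcCoeff 𝕂 G a n with hy₀
  have hΓ0 : ∀ y, Γ (0, y) = 0 := fun y => arc_zero _ _
  have hf : AnalyticAt 𝕂 (fun p => G (Γ p)) ((0 : 𝕂), y₀) :=
    AnalyticAt.fun_comp (by rw [hΓ0]; exact hG) (hΓa _)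
  have hexp : ∀ y, (fun ε : 𝕂 => G (Γ (ε, y)) - ε ^ n • (y - y₀)) =O[𝓝[≠] 0]
      fun ε : 𝕂 => ε ^ (n + 1) := by
    intro y
    refine ((comp_arc_expansion hG (a + shift 𝕂 M (A y)) n).mono nhdsWithin_le_nhds).congr_left
      fun ε => ?_
    rw [Finset.sum_range_succ, Finset.sum_eq_zero, zero_add, hn,
      arcCoeff_add_shift hG hM ha _ le_rfl, (hA y).2, hy₀, sub_neg_eq_add, add_comm y, ← hn]
    intro m hm
    have hm := Finset.mem_range.1 hm
    rcases Nat.lt_or_ge M m with h | h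
    · obtain ⟨s, rfl⟩ := Nat.exists_eq_add_of_le (Nat.succ_le_of_lt h)
      rw [arcCoeff_add_shift hG hM ha _ (by omega), hsol _ (by omega), zero_add,
        (mem_chains G zbar).1 (hA y).1 s (by omega), smul_zero]
    · rw [arcCoeff_add_shift_of_le _ h, hsol _ (by omega), smul_zero]
  obtain ⟨g, hg, hfg, hg0⟩ := exists_analyticAt_pow_smul n (c := fun y => y - y₀) hf
    (Eventually.of_forall hexp)
  obtain ⟨ψ, hψ, hψ0, hgψ⟩ := exists_analyticAt_zero hg hg0
  have hpair : AnalyticAt 𝕂 (fun ε : 𝕂 => (ε, ψ ε)) 0 := analyticAt_id.prod hψ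
  have hγ : AnalyticAt 𝕂 (fun ε : 𝕂 => Γ (ε, ψ ε)) 0 := AnalyticAt.fun_comp (hΓa _) hpair
  have htend : Tendsto (fun ε : 𝕂 => (ε, ψ ε)) (𝓝 0) (𝓝 (0, y₀)) := by
    have := hpair.continuousAt.tendsto
    rwa [hψ0] at this
  refine ⟨fun ε => Γ (ε, ψ ε), hγ, hΓ0 _, ?_, fun i hi => ?_⟩
  · filter_upwards [htend.eventually hfg, hgψ] with ε h1 h2
    rw [h1, h2, smul_zero]
  -- The inserted `A (ψ ε)` varies with `ε` but stays bounded, and it enters with the power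
  -- `ε^(M+1)` at least. So the first `M` coefficients of the solution are those of `a`.
  · have hO : (fun ε : 𝕂 => Γ (ε, ψ ε) - ∑ m ∈ Finset.range (M + 1),
        ε ^ m • (if m = 0 then 0 else a (m - 1))) =O[𝓝 0] fun ε : 𝕂 => ε ^ (M + 1) := by
      have h1 : (fun ε : 𝕂 => ∑ j ∈ Finset.range (1 + k), ε ^ (M + j + 1) •
          (a (M + j) + A (ψ ε) j)) =O[𝓝 0] fun ε : 𝕂 => ε ^ (M + 1) := by
        refine IsBigO.fun_sum (A := fun j (ε : 𝕂) => ε ^ (M + j + 1) •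
          (a (M + j) + A (ψ ε) j)) fun j _ => ?_
        have h2 : (fun ε : 𝕂 => a (M + j) + A (ψ ε) j) =O[𝓝 0] fun _ : 𝕂 => (1 : 𝕂) := by
          have h3 : ContinuousAt (fun ε : 𝕂 => a (M + j) + A (ψ ε) j) 0 :=
            continuousAt_const.add (ContinuousAt.comp
              (g := (ContinuousLinearMap.proj (R := 𝕂) (φ := fun _ : ℕ => B) j ∘L A : B' →L[𝕂] B))
              (ContinuousLinearMap.continuous _).continuousAt hψ.continuousAt)
          exact h3.tendsto.isBigO_one 𝕂
        simpa using (isBigO_pow_pow (𝕂 := 𝕂) (show M + 1 ≤ M + j + 1 by omega)).smul h2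
      refine h1.congr_left fun ε => ?_
      rw [Finset.sum_range_succ']
      simp only [Nat.add_eq_zero_iff, one_ne_zero, and_false, if_false, if_true, smul_zero,
        add_zero, Nat.add_sub_cancel]
      rw [hΓ]
      simp only [arc]
      symm
      rw [hn, add_assoc M 1 k, Finset.sum_range_add _ M (1 + k), add_sub_right_comm, ← Finset.sum_sub_distrib,
        Finset.sum_eq_zero, zero_add]
      · refine Finset.sum_congr rfl fun j _ => ?_
        rw [Pi.add_apply, shift_add]
      · intro j hj
        rw [Pi.add_apply, shift_of_lt (Finset.mem_range.1 hj), add_zero, sub_self]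
    have h1 := tcoeff_eq_of_isBigO hγ hO (i + 1) (by omega)
    rw [if_neg (by omega), Nat.add_sub_cancel] at h1
    rw [← h1, tcoeff, smul_smul, mul_inv_cancel₀ (by exact_mod_cast (i + 1).factorial_ne_zero),
      one_smul]

end Lift

/-! ### Calculus of polynomial operators. -/

section PolyOp

variable {𝕂 E F H : Type*} [RCLike 𝕂] [NormedAddCommGroup E] [NormedSpace 𝕂 E]
  [NormedAddCommGroup F] [NormedSpace 𝕂 F] [NormedAddCommGroup H] [NormedSpace 𝕂 H]

theorem IsPolyOp.zero (d : ℕ) : IsPolyOp 𝕂 d (fun _ : E => (0 : F)) :=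
  ⟨fun _ => 0, fun x => by simp⟩

theorem IsPolyOp.add {d : ℕ} {f g : E → F} (hf : IsPolyOp 𝕂 d f) (hg : IsPolyOp 𝕂 d g) :
    IsPolyOp 𝕂 d (fun x => f x + g x) := by
  obtain ⟨p, hp⟩ := hf
  obtain ⟨q, hq⟩ := hg
  exact ⟨fun j => p j + q j, fun x => by simp [hp, hq, Finset.sum_add_distrib]⟩

theorem IsPolyOp.sum {ι : Type*} {d : ℕ} (s : Finset ι) {f : ι → E → F}
    (h : ∀ i ∈ s, IsPolyOp 𝕂 d (f i)) : IsPolyOp 𝕂 d (fun x => ∑ i ∈ s, f i x) := by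
  classical
  induction s using Finset.induction_on with
  | empty => simpa using IsPolyOp.zero d
  | insert a s ha ih =>
    simp only [Finset.sum_insert ha]
    exact (h a (Finset.mem_insert_self a s)).add (ih fun i hi => h i (Finset.mem_insert_of_mem hi))

theorem isPolyOp_diagonal {ι : Type*} [Fintype ι] {d : ℕ} (h : Fintype.card ι ≤ d)
    (M : ContinuousMultilinearMap 𝕂 (fun _ : ι => E) F) : IsPolyOp 𝕂 d (fun x => M fun _ => x) := by
  refine ⟨fun j => if hj : Fintype.card ι = j then
    M.domDomCongr ((Fintype.equivFin ι).trans (finCongr hj)) else 0, fun x => ?_⟩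
  rw [Finset.sum_eq_single_of_mem (Fintype.card ι) (by simpa [Nat.lt_succ_iff] using h)]
  · dsimp only
    rw [dif_pos rfl, ContinuousMultilinearMap.domDomCongr_apply]
  · intro j _ hj
    dsimp only
    rw [dif_neg (Ne.symm hj)]; rfl

theorem IsPolyOp.mono {d d' : ℕ} {f : E → F} (hf : IsPolyOp 𝕂 d f) (h : d ≤ d') :
    IsPolyOp 𝕂 d' f := by
  obtain ⟨p, hp⟩ := hf
  rw [funext hp]
  refine IsPolyOp.sum _ fun j hj => isPolyOp_diagonal ?_ (p j)
  have := Finset.mem_range.1 hj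
  rw [Fintype.card_fin]; omega

theorem IsPolyOp.const (d : ℕ) (c : F) : IsPolyOp 𝕂 d (fun _ : E => c) :=
  (isPolyOp_diagonal (by simp) (ContinuousMultilinearMap.constOfIsEmpty 𝕂 (fun _ : Fin 0 => E) c) :
    IsPolyOp 𝕂 d _)

theorem isPolyOp_continuousLinearMap {d : ℕ} (hd : 1 ≤ d) (L : E →L[𝕂] F) : IsPolyOp 𝕂 d L := by
  have := isPolyOp_diagonal (d := d) (by simpa using hd)
    (ContinuousMultilinearMap.ofSubsingleton 𝕂 E F (0 : Fin 1) L)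
  simpa using this

theorem IsPolyOp.continuousLinearMap_comp {d : ℕ} {f : E → F} (hf : IsPolyOp 𝕂 d f)
    (L : F →L[𝕂] H) : IsPolyOp 𝕂 d (fun x => L (f x)) := by
  obtain ⟨p, hp⟩ := hf
  exact ⟨fun j => L.compContinuousMultilinearMap (p j), fun x => by simp [hp]⟩

theorem IsPolyOp.clm_apply {d e : ℕ} {Φ : E → F →L[𝕂] H} {f : E → F} (hΦ : IsPolyOp 𝕂 d Φ)
    (hf : IsPolyOp 𝕂 e f) : IsPolyOp 𝕂 (d + e) (fun x => Φ x (f x)) := by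
  obtain ⟨p, hp⟩ := hΦ
  obtain ⟨q, hq⟩ := hf
  have : (fun x => Φ x (f x)) = fun x => ∑ i ∈ Finset.range (d + 1), ∑ j ∈ Finset.range (e + 1),
      p i (fun _ => x) (q j fun _ => x) := by
    ext x
    rw [hp, hq, sum_apply]
    simp only [map_sum]
  rw [this]
  refine IsPolyOp.sum _ fun i hi => IsPolyOp.sum _ fun j hj => ?_
  have hi := Finset.mem_range.1 hi
  have hj := Finset.mem_range.1 hj
  set M : ContinuousMultilinearMap 𝕂 (fun _ : Fin i ⊕ Fin j => E) H :=
    ContinuousMultilinearMap.uncurrySum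
      (((ContinuousLinearMap.compContinuousMultilinearMapL 𝕂 (fun _ : Fin j => E) F H).flip
        (q j)).compContinuousMultilinearMap (p i)) with hM
  have h := isPolyOp_diagonal (d := d + e) (by
    rw [Fintype.card_sum, Fintype.card_fin, Fintype.card_fin]; omega) M
  exact h

/-- Induction by currying off the first argument. The multilinear map must be allowed to depend on
`x`, because after one application it does. -/
theorem IsPolyOp.multilinear_apply : ∀ {n : ℕ} {d₀ : ℕ} {d : Fin n → ℕ}
    {Φ : E → ContinuousMultilinearMap 𝕂 (fun _ : Fin n => F) H} {f : Fin n → E → F},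
    IsPolyOp 𝕂 d₀ Φ → (∀ i, IsPolyOp 𝕂 (d i) (f i)) →
    IsPolyOp 𝕂 (d₀ + ∑ i, d i) (fun x => Φ x fun i => f i x)
  | 0, d₀, d, Φ, f, hΦ, _ => by
    have := hΦ.continuousLinearMap_comp
      (ContinuousMultilinearMap.apply 𝕂 (fun _ : Fin 0 => F) H (fun i => i.elim0))
    simp only [Finset.univ_eq_empty, Finset.sum_empty, add_zero]
    convert this using 2 with x
    rw [ContinuousMultilinearMap.apply_apply]
    congr 1
    ext1 i
    exact i.elim0
  | n + 1, d₀, d, Φ, f, hΦ, hf => by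
    have h1 := (hΦ.continuousLinearMap_comp ((continuousMultilinearCurryLeftEquiv 𝕂
      (fun _ : Fin (n + 1) => F) H).toContinuousLinearEquiv :
      ContinuousMultilinearMap 𝕂 (fun _ : Fin (n + 1) => F) H →L[𝕂]
        (F →L[𝕂] ContinuousMultilinearMap 𝕂 (fun _ : Fin n => F) H))).clm_apply (hf 0)
    have h2 := IsPolyOp.multilinear_apply h1 fun i => hf i.succ
    rw [Fin.sum_univ_succ, ← add_assoc]
    convert h2 using 2 with x
    change _ = Φ x (Fin.cons _ _)
    congr 1
    ext1 i
    refine Fin.cases ?_ (fun i => ?_) i <;> simp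

theorem IsPolyOp.isPolyInCoordinates {d : ℕ} {f : E → F} (hf : IsPolyOp 𝕂 d f) :
    IsPolyInCoordinates 𝕂 d f := by
  obtain ⟨p, hp⟩ := hf
  intro r s e c
  refine ⟨fun i => ∑ j ∈ Finset.range (d + 1), ∑ w : Fin j → Fin r,
    MvPolynomial.C (c.repr (p j fun t => e (w t)) i) * ∏ t, MvPolynomial.X (w t), ?_, ?_⟩
  · intro i
    refine MvPolynomial.totalDegree_finsetSum_le fun j hj => ?_
    refine MvPolynomial.totalDegree_finsetSum_le fun w _ => ?_
    refine (MvPolynomial.totalDegree_mul _ _).trans ?_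
    rw [MvPolynomial.totalDegree_C, zero_add]
    refine (MvPolynomial.totalDegree_finsetProd _ _).trans ?_
    simp only [MvPolynomial.totalDegree_X, Finset.sum_const, Finset.card_univ, Fintype.card_fin,
      smul_eq_mul, mul_one]
    have := Finset.mem_range.1 hj
    omega
  · intro x i
    have h1 : ∀ j, p j (fun _ => x) = ∑ w : Fin j → Fin r,
        (∏ t, e.repr x (w t)) • p j (fun t => e (w t)) := by
      intro j
      conv_lhs => rw [← e.sum_repr x]
      rw [ContinuousMultilinearMap.map_sum]
      exact Finset.sum_congr rfl fun w _ =>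
        (p j).map_smul_univ (fun t => e.repr x (w t)) (fun t => e (w t))
    rw [hp]
    simp only [h1, map_sum, map_smul, Finsupp.coe_finsetSum, Finset.sum_apply, Finsupp.smul_apply,
      smul_eq_mul, map_mul, map_prod, MvPolynomial.eval_C, MvPolynomial.eval_X]
    exact Finset.sum_congr rfl fun j _ => Finset.sum_congr rfl fun w _ => mul_comm _ _

end PolyOp

/-! ### Faà di Bruno's formula and the degree count. -/

section ArcCoeff

open Asymptotics

variable {𝕂 E B B' : Type*} [RCLike 𝕂] [NormedAddCommGroup B] [NormedSpace 𝕂 B]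
  [NormedAddCommGroup B'] [NormedSpace 𝕂 B'] [NormedAddCommGroup E] [NormedSpace 𝕂 E]

theorem tcoeff_arc [CompleteSpace B] (a : ℕ → B) {m r : ℕ} (hr : r < m) :
    tcoeff (arc a m : 𝕂 → B) (r + 1) = a r := by
  have h := tcoeff_eq_of_isBigO (n := m + 1) (c := fun j => if j = 0 then 0 else a (j - 1))
    (analyticAt_arc (𝕂 := 𝕂) a m 0) ?_ (r + 1) (by omega)
  · simpa using h
  · refine (isBigO_zero (fun ε : 𝕂 => ε ^ (m + 1)) (𝓝 0)).congr_left fun ε => ?_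
    rw [Finset.sum_range_succ']
    simp [arc]

/-- The formula of Faà di Bruno for the coefficients of `G` along an arc. -/
theorem arcCoeff_eq_sum [CompleteSpace B] [CompleteSpace B'] {G : B → B'}
    {p : FormalMultilinearSeries 𝕂 B B'} (hp : HasFPowerSeriesAt G p 0) (a : ℕ → B) (m : ℕ) :
    arcCoeff 𝕂 G a m =
      ∑ c : Composition m, p c.length fun i => a (c.blocksFun i - 1) := by
  obtain ⟨q, hq⟩ := analyticAt_arc (𝕂 := 𝕂) a m 0
  have hcomp : HasFPowerSeriesAt (fun ε : 𝕂 => G (arc a m ε)) (p.comp q) 0 :=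
    HasFPowerSeriesAt.comp (by rwa [arc_zero]) hq
  rw [arcCoeff, tcoeff_eq_coeff hcomp, FormalMultilinearSeries.coeff, FormalMultilinearSeries.comp,
    sum_apply]
  refine Finset.sum_congr rfl fun c _ => ?_
  rw [FormalMultilinearSeries.compAlongComposition_apply]
  congr 1
  ext1 i
  have h1 : 1 ≤ c.blocksFun i := c.one_le_blocksFun i
  have h2 : c.blocksFun i ≤ m := c.blocksFun_le i
  have h3 := tcoeff_eq_coeff hq (c.blocksFun i)
  have h4 := tcoeff_arc (𝕂 := 𝕂) a (show c.blocksFun i - 1 < m by omega)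
  rw [Nat.sub_add_cancel h1, h3] at h4
  rw [← h4]
  rfl

theorem isPolyOp_arcCoeff [CompleteSpace B] [CompleteSpace B'] {G : B → B'}
    (hG : AnalyticAt 𝕂 G 0) {a : E → ℕ → B} {δ : ℕ → ℕ} {m D : ℕ}
    (ha : ∀ r, IsPolyOp 𝕂 (δ r) (fun x => a x r))
    (hD : ∀ c : Composition m, ∑ i, δ (c.blocksFun i - 1) ≤ D) :
    IsPolyOp 𝕂 D (fun x => arcCoeff 𝕂 G (a x) m) := by
  obtain ⟨p, hp⟩ := hG
  simp only [arcCoeff_eq_sum hp]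
  refine IsPolyOp.sum _ fun c _ => ?_
  have h := IsPolyOp.multilinear_apply (IsPolyOp.const 0 (p c.length))
    fun i => ha (c.blocksFun i - 1)
  exact h.mono (by rw [zero_add]; exact hD c)

/-- If two of the `b j` exceed `k`, truncation takes away `2k` at least and `i + 1` remains. If only
one does, the cap `i` on its term suffices; otherwise all terms vanish. -/
theorem sum_min_sub_le {ι : Type*} [Fintype ι] (b : ι → ℕ) {k i : ℕ}
    (hb : ∑ j, b j = 2 * k + i + 1) : ∑ j, min (b j - k) i ≤ i + 1 := by
  classical
  by_cases h : ∃ j j', j ≠ j' ∧ k < b j ∧ k < b j'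
  · obtain ⟨j, j', hne, hj, hj'⟩ := h
    have hmem : j' ∈ Finset.univ.erase j := Finset.mem_erase.2 ⟨hne.symm, Finset.mem_univ _⟩
    rw [← Finset.add_sum_erase _ _ (Finset.mem_univ j), ← Finset.add_sum_erase _ _ hmem] at hb ⊢
    have h1 : ∑ t ∈ (Finset.univ.erase j).erase j', min (b t - k) i ≤
        ∑ t ∈ (Finset.univ.erase j).erase j', b t := Finset.sum_le_sum fun t _ => by omega
    omega
  · push Not at h
    by_cases h' : ∃ j, k < b j
    · obtain ⟨j, hj⟩ := h'
      rw [Finset.sum_eq_single_of_mem j (Finset.mem_univ j)]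
      · omega
      · intro t _ ht
        have := h j t ht.symm hj
        omega
    · push Not at h'
      rw [Finset.sum_eq_zero]
      · omega
      · intro t _
        have := h' t
        omega

end ArcCoeff

/-! ### Passage between the tuples `zᵢ` and the Taylor coefficients `zᵢ / i!`. -/

section Normalize

variable {𝕂 B B' : Type*} [RCLike 𝕂] [NormedAddCommGroup B] [NormedSpace 𝕂 B]
  [NormedAddCommGroup B'] [NormedSpace 𝕂 B']

theorem factorial_smul_inv_smul (n : ℕ) (x : B) :
    (n.factorial : 𝕂) • ((n.factorial : 𝕂)⁻¹ • x) = x :=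
  smul_inv_smul₀ (by exact_mod_cast n.factorial_ne_zero) x

theorem factorial_inv_smul_smul (n : ℕ) (x : B) :
    (n.factorial : 𝕂)⁻¹ • ((n.factorial : 𝕂) • x) = x :=
  inv_smul_smul₀ (by exact_mod_cast n.factorial_ne_zero) x

theorem normalize_of_lt {n i : ℕ} (z : Fin n → B) (h : i < n) :
    normalize 𝕂 z i = (((i + 1).factorial : 𝕂)⁻¹) • z ⟨i, h⟩ := dif_pos h

theorem factorial_smul_normalize {n : ℕ} (z : Fin n → B) (i : Fin n) :
    (((i : ℕ) + 1).factorial : 𝕂) • normalize 𝕂 z i = z i := by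
  rw [normalize_of_lt z i.2, factorial_smul_inv_smul]

/-- The tuple `(1! a₀, 2! a₁, …, n! aₙ₋₁)`. -/
def denormalize (𝕂 : Type*) {B : Type*} [RCLike 𝕂] [NormedAddCommGroup B] [NormedSpace 𝕂 B]
    (n : ℕ) (a : ℕ → B) (i : Fin n) : B := (((i : ℕ) + 1).factorial : 𝕂) • a i

theorem T_eq (G : B → B') {m : ℕ} (z : Fin m → B) :
    T 𝕂 G z = (m.factorial : 𝕂) • arcCoeff 𝕂 G (normalize 𝕂 z) m := by
  rw [T, curve_eq_arc, arcCoeff, tcoeff, factorial_smul_inv_smul]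

/-- The sequences starting with `z̄` along which the coefficients of `G` vanish up to order `n`. -/
def IsSol (𝕂 : Type*) {B B' : Type*} [RCLike 𝕂] [NormedAddCommGroup B] [NormedSpace 𝕂 B]
    [NormedAddCommGroup B'] [NormedSpace 𝕂 B'] (G : B → B') {k : ℕ} (zbar : Fin k → B)
    (n : ℕ) (a : ℕ → B) : Prop :=
  (∀ i < k, a i = normalize 𝕂 zbar i) ∧ ∀ m ≤ n, arcCoeff 𝕂 G a m = 0

variable {G : B → B'} {k : ℕ} {zbar : Fin k → B}

theorem IsSol.mono {n n' : ℕ} {a : ℕ → B} (h : IsSol 𝕂 G zbar n a) (hn : n' ≤ n) :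
    IsSol 𝕂 G zbar n' a := ⟨h.1, fun m hm => h.2 m (hm.trans hn)⟩

theorem IsSol.congr {n : ℕ} {a b : ℕ → B} (h : IsSol 𝕂 G zbar n a) (hk : k ≤ n)
    (hab : ∀ i < n, b i = a i) : IsSol 𝕂 G zbar n b :=
  ⟨fun i hi => (hab i (by omega)).trans (h.1 i hi), fun m hm =>
    (arcCoeff_congr fun i hi => hab i (by omega)).trans (h.2 m hm)⟩

theorem arcCoeff_zero_order (hG0 : G 0 = 0) (a : ℕ → B) : arcCoeff 𝕂 G a 0 = 0 := by
  simp [arcCoeff, tcoeff, hG0]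

theorem mem_X_iff (hG0 : G 0 = 0) {n : ℕ} {z : Fin n → B} {a : ℕ → B}
    (ha : ∀ i : Fin n, z i = (((i : ℕ) + 1).factorial : 𝕂) • a i) :
    z ∈ X 𝕂 G n ↔ ∀ m ≤ n, arcCoeff 𝕂 G a m = 0 := by
  have key : ∀ (m : ℕ) (h : m ≤ n), T 𝕂 G (trunc h z) = (m.factorial : 𝕂) • arcCoeff 𝕂 G a m := by
    intro m h
    rw [T_eq]
    congr 1
    refine arcCoeff_congr fun i hi => ?_
    rw [normalize_of_lt _ hi, trunc, ha, Fin.val_castLE, factorial_inv_smul_smul]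
  constructor
  · intro hz m hm
    rcases Nat.eq_zero_or_pos m with rfl | h1
    · exact arcCoeff_zero_order hG0 a
    · have := hz m hm h1
      rw [key] at this
      exact (smul_eq_zero.1 this).resolve_left (by exact_mod_cast m.factorial_ne_zero)
  · intro hz m hm _
    rw [key, hz m hm, smul_zero]

theorem mem_XBar_iff (hG0 : G 0 = 0) {n : ℕ} (hk : k ≤ n) {z : Fin n → B} {a : ℕ → B}
    (ha : ∀ i : Fin n, z i = (((i : ℕ) + 1).factorial : 𝕂) • a i) :
    z ∈ XBar 𝕂 G zbar n ↔ IsSol 𝕂 G zbar n a := by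
  rw [XBar, Set.mem_ofPred_eq, mem_X_iff hG0 ha, IsSol, and_comm]
  refine and_congr_left fun _ => ⟨fun h i hi => ?_, fun h i j hij => ?_⟩
  · rw [normalize_of_lt _ hi, ← h ⟨i, hi⟩ ⟨i, hi.trans_le hk⟩ rfl, ha, factorial_inv_smul_smul]
  · rw [ha, ← hij, h i i.2, factorial_smul_normalize]

theorem normalize_isSol (hG0 : G 0 = 0) {n : ℕ} (hk : k ≤ n) {z : Fin n → B} :
    z ∈ XBar 𝕂 G zbar n ↔ IsSol 𝕂 G zbar n (normalize 𝕂 z) :=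
  mem_XBar_iff hG0 hk fun i => (factorial_smul_normalize z i).symm

theorem denormalize_mem_XBar (hG0 : G 0 = 0) {n : ℕ} (hk : k ≤ n) {a : ℕ → B} :
    denormalize 𝕂 n a ∈ XBar 𝕂 G zbar n ↔ IsSol 𝕂 G zbar n a :=
  mem_XBar_iff hG0 hk fun _ => rfl

theorem mem_XBarInf_iff (hG0 : G 0 = 0) (a : ℕ → B) :
    (fun i => (((i + 1).factorial : 𝕂)) • a i) ∈ XBarInf 𝕂 G zbar ↔
      ∀ n, IsSol 𝕂 G zbar n a := by
  have h1 : ∀ n, truncInf n (fun i => (((i + 1).factorial : 𝕂)) • a i) ∈ X 𝕂 G n ↔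
      ∀ m ≤ n, arcCoeff 𝕂 G a m = 0 := fun n => mem_X_iff hG0 fun _ => rfl
  constructor
  · rintro ⟨h2, h3⟩ n
    refine ⟨fun i hi => ?_, (h1 n).1 (h2 n)⟩
    rw [normalize_of_lt _ hi, ← congrFun h3 ⟨i, hi⟩, truncInf, factorial_inv_smul_smul]
  · intro h
    refine ⟨fun n => (h1 n).2 (h n).2, funext fun i => ?_⟩
    rw [truncInf, (h 0).1 i i.2, factorial_smul_normalize]

end Normalize

/-! ### Correcting solutions order by order. -/

section Solutions

variable {𝕂 B B' : Type*} [RCLike 𝕂] [NormedAddCommGroup B] [NormedSpace 𝕂 B]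
  [NormedAddCommGroup B'] [NormedSpace 𝕂 B']
  {G : B → B'} {k : ℕ} {zbar : Fin k → B}

/-- The correction that makes an approximate solution of order `M + k` a solution of order
`M + k + 1`. -/
def extend (G : B → B') (k : ℕ) (A : B' →L[𝕂] (ℕ → B)) (M : ℕ) (a : ℕ → B) : ℕ → B :=
  a + shift 𝕂 M (A (-arcCoeff 𝕂 G a (M + 1 + k)))

theorem extend_of_lt (A : B' →L[𝕂] (ℕ → B)) {M i : ℕ} (h : i < M) (a : ℕ → B) :
    extend G k A M a i = a i := by
  rw [extend, Pi.add_apply, shift_of_lt h, add_zero]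

variable [CompleteSpace B']

theorem IsSol.add_shift {n M s : ℕ} {a v : ℕ → B} (h : IsSol 𝕂 G zbar n a)
    (hG : AnalyticAt 𝕂 G 0) (hM : k ≤ M) (hv : v ∈ chains 𝕂 G zbar s) (hs : s ≤ k + 1)
    (hn : n ≤ M + s) : IsSol 𝕂 G zbar n (a + shift 𝕂 M v) := by
  refine ⟨fun i hi => ?_, fun m hm => ?_⟩
  · rw [Pi.add_apply, shift_of_lt (by omega), add_zero, h.1 i hi]
  · rcases Nat.lt_or_ge M m with h1 | h1
    · obtain ⟨t, rfl⟩ := Nat.exists_eq_add_of_le (Nat.succ_le_of_lt h1)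
      rw [arcCoeff_add_shift hG hM h.1 _ (by omega), h.2 _ hm, zero_add,
        (mem_chains G zbar).1 hv t (by omega)]
    · rw [arcCoeff_add_shift_of_le _ h1, h.2 _ hm]

theorem IsSol.sub_mem_chains {n M s : ℕ} {a b : ℕ → B} (ha : IsSol 𝕂 G zbar n a)
    (hb : IsSol 𝕂 G zbar n b) (hG : AnalyticAt 𝕂 G 0) (hM : k ≤ M) (hab : ∀ i < M, b i = a i)
    (hs : s ≤ k + 1) (hn : M + s ≤ n) :
    (fun j => b (M + j) - a (M + j)) ∈ chains 𝕂 G zbar s := by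
  refine (mem_chains G zbar).2 fun t ht => ?_
  rw [← arcCoeff_sub_eq_residual hG zbar hM ha.1 hab (by omega), ha.2 _ (by omega),
    hb.2 _ (by omega), sub_zero]

variable {A : B' →L[𝕂] (ℕ → B)}

theorem IsSol.extend {M : ℕ} {a : ℕ → B} (h : IsSol 𝕂 G zbar (M + k) a)
    (hG : AnalyticAt 𝕂 G 0)
    (hA : ∀ y, A y ∈ chains 𝕂 G zbar k ∧ residual 𝕂 G zbar k (A y) = y) (hM : k ≤ M) :
    IsSol 𝕂 G zbar (M + 1 + k) (extend G k A M a) := by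
  have h1 := h.add_shift hG hM (hA (-arcCoeff 𝕂 G a (M + 1 + k))).1 (Nat.le_succ k) le_rfl
  refine ⟨h1.1, fun m hm => ?_⟩
  rcases Nat.lt_or_ge (M + k) m with h2 | h2
  · obtain rfl : m = M + 1 + k := by omega
    rw [KRegular.extend, arcCoeff_add_shift hG hM h.1 _ le_rfl, (hA _).2, add_neg_cancel]
  · exact h1.2 m h2

theorem IsSol.exists_formal_solution {M : ℕ} {a : ℕ → B} (h : IsSol 𝕂 G zbar (M + k) a)
    (hG : AnalyticAt 𝕂 G 0)
    (hA : ∀ y, A y ∈ chains 𝕂 G zbar k ∧ residual 𝕂 G zbar k (A y) = y) (hM : k ≤ M) :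
    ∃ b : ℕ → B, (∀ n, IsSol 𝕂 G zbar n b) ∧ ∀ r < M, b r = a r := by
  set s : ℕ → ℕ → B := fun j => Nat.rec a (fun j w => KRegular.extend G k A (M + j) w) j with hs
  have hs1 : ∀ j, s (j + 1) = KRegular.extend G k A (M + j) (s j) := fun _ => rfl
  have hsol : ∀ j, IsSol 𝕂 G zbar (M + j + k) (s j) := by
    intro j
    induction j with
    | zero => exact h
    | succ j ih => rw [hs1]; exact ih.extend hG hA (by omega)
  have hstep : ∀ i d r, r < M + i → s (i + d) r = s i r := by
    intro i d r hr
    induction d with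
    | zero => rfl
    | succ d ih => rw [← add_assoc, hs1, extend_of_lt _ (by omega), ih]
  -- Entry `r` is final from step `j` on as soon as `r < M + j`, so the diagonal sequence agrees
  -- with `s j` below `M + j`.
  have hb : ∀ j r, r < M + j → s (r + 1) r = s j r := by
    intro j r hr
    rcases Nat.le_total (r + 1) j with h1 | h1
    · obtain ⟨d, rfl⟩ := Nat.exists_eq_add_of_le h1
      rw [hstep _ d r (by omega)]
    · obtain ⟨d, hd⟩ := Nat.exists_eq_add_of_le h1
      rw [hd, hstep j d r hr]
  refine ⟨fun r => s (r + 1) r, fun n => ?_, fun r hr => hb 0 r hr⟩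
  exact (((hsol (n + k)).mono (by omega : n + k ≤ _)).congr (b := fun r => s (r + 1) r) (by omega)
    fun i hi => hb (n + k) i (by omega)).mono (by omega)

end Solutions

/-! ### Finite families continued by zero. -/

section Extension

variable {𝕂 : Type*} [RCLike 𝕂] {V : ℕ → Type*} [∀ i, NormedAddCommGroup (V i)]
  [∀ i, NormedSpace 𝕂 (V i)]

/-- The continuation of a finite family by zero. -/
def extendZero {l : ℕ} (q : (i : Fin l) → V i) (i : ℕ) : V i :=
  if h : i < l then q ⟨i, h⟩ else 0

theorem extendZero_of_lt {l i : ℕ} (q : (i : Fin l) → V i) (h : i < l) :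
    extendZero q i = q ⟨i, h⟩ := dif_pos h

theorem extendZero_of_le {l i : ℕ} (q : (i : Fin l) → V i) (h : l ≤ i) :
    extendZero q i = 0 := dif_neg (by omega)

/-- The components of `extendZero` as continuous linear mappings. -/
def extendZeroL (𝕂 : Type*) [RCLike 𝕂] (V : ℕ → Type*) [∀ i, NormedAddCommGroup (V i)]
    [∀ i, NormedSpace 𝕂 (V i)] (l i : ℕ) : ((i : Fin l) → V i) →L[𝕂] V i :=
  if h : i < l then ContinuousLinearMap.proj (R := 𝕂) (φ := fun i : Fin l => V i) ⟨i, h⟩ else 0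

theorem extendZeroL_apply {l i : ℕ} (q : (i : Fin l) → V i) :
    extendZeroL 𝕂 V l i q = extendZero q i := by
  by_cases h : i < l
  · simp [extendZeroL, extendZero, h]
  · simp [extendZeroL, extendZero, h]

end Extension

/-! ### The solution families and their degrees. -/

section Families

variable {𝕂 B B' : Type*} [RCLike 𝕂] [NormedAddCommGroup B] [NormedSpace 𝕂 B]
  [NormedAddCommGroup B'] [NormedSpace 𝕂 B']

/-- The solutions of order `2k + i` that are obtained from `a₀` by `i` extensions. In the `i`-th
step the parameter `q i` from the subspace `V` is put into the coefficient of order `k + i + 1`,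
and continued by `E`. -/
def solFamily (G : B → B') (k : ℕ) (A : B' →L[𝕂] (ℕ → B)) {V : Submodule 𝕂 B}
    (E : V →L[𝕂] (ℕ → B)) (a₀ : ℕ → B) (q : ℕ → V) : ℕ → ℕ → B
  | 0 => a₀
  | i + 1 => extend G k A (k + i) (solFamily G k A E a₀ q i) +
      shift 𝕂 (k + i) (E (((k + i + 1).factorial : 𝕂)⁻¹ • q i))

/-- The sequences that are obtained from `w` by putting the parameters `n j` from the subspaces
`V j` into the coefficients of order `M + j + 1`, and continuing them by `E j`. -/
def tailFamily {V : ℕ → Submodule 𝕂 B} (E : (j : ℕ) → V j →L[𝕂] (ℕ → B)) (M : ℕ) (w : ℕ → B)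
    (n : (j : ℕ) → V j) : ℕ → ℕ → B
  | 0 => w
  | j + 1 => tailFamily E M w n j +
      shift 𝕂 (M + j) (E j (((M + j + 1).factorial : 𝕂)⁻¹ • n j))

variable {G : B → B'} {k : ℕ} {zbar : Fin k → B} {A : B' →L[𝕂] (ℕ → B)} {V : Submodule 𝕂 B}
  {E : V →L[𝕂] (ℕ → B)} {a₀ : ℕ → B}

theorem solFamily_congr {q q' : ℕ → V} : ∀ {i : ℕ}, (∀ j < i, q j = q' j) →
    solFamily G k A E a₀ q i = solFamily G k A E a₀ q' i
  | 0, _ => rfl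
  | i + 1, h => by
    rw [solFamily, solFamily, solFamily_congr fun j hj => h j (by omega), h i (by omega)]

theorem solFamily_stable (q : ℕ → V) {i r : ℕ} (hr : r < k + i) (d : ℕ) :
    solFamily G k A E a₀ q (i + d) r = solFamily G k A E a₀ q i r := by
  induction d with
  | zero => rfl
  | succ d ih =>
    rw [← add_assoc, solFamily, Pi.add_apply, shift_of_lt (by omega), add_zero,
      extend_of_lt _ (by omega), ih]

/-- The triangular structure: the new parameter enters its own coefficient additively, and the rest
depends on earlier parameters only. Setting `q' i = 0` isolates this rest. -/
theorem solFamily_apply (hE : ∀ n, E n 0 = n) {q q' : ℕ → V} {i l : ℕ} (hi : i < l)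
    (hq : ∀ j < i, q j = q' j) (hq' : q' i = 0) :
    solFamily G k A E a₀ q l (k + i) = solFamily G k A E a₀ q' (i + 1) (k + i) +
      ((k + i + 1).factorial : 𝕂)⁻¹ • (q i : B) := by
  obtain ⟨d, rfl⟩ := Nat.exists_eq_add_of_le (Nat.succ_le_of_lt hi)
  rw [solFamily_stable q (by omega), solFamily, solFamily, solFamily_congr hq, hq', smul_zero,
    map_zero, map_zero, add_zero, Pi.add_apply]
  congr 1
  have := shift_add (𝕂 := 𝕂) (k + i) 0 (E (((k + i + 1).factorial : 𝕂)⁻¹ • q i))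
  rw [add_zero] at this
  rw [this, hE]
  rfl

theorem tailFamily_congr {V : ℕ → Submodule 𝕂 B} {E : (j : ℕ) → V j →L[𝕂] (ℕ → B)} {M : ℕ}
    {w : ℕ → B} {n n' : (j : ℕ) → V j} : ∀ {i : ℕ}, (∀ j < i, n j = n' j) →
    tailFamily E M w n i = tailFamily E M w n' i
  | 0, _ => rfl
  | i + 1, h => by
    rw [tailFamily, tailFamily, tailFamily_congr fun j hj => h j (by omega), h i (by omega)]

theorem tailFamily_stable {V : ℕ → Submodule 𝕂 B} {E : (j : ℕ) → V j →L[𝕂] (ℕ → B)} {M : ℕ}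
    {w : ℕ → B} (n : (j : ℕ) → V j) {i r : ℕ} (hr : r < M + i) (d : ℕ) :
    tailFamily E M w n (i + d) r = tailFamily E M w n i r := by
  induction d with
  | zero => rfl
  | succ d ih =>
    rw [← add_assoc, tailFamily, Pi.add_apply, shift_of_lt (by omega), add_zero, ih]

theorem tailFamily_apply {V : ℕ → Submodule 𝕂 B} {E : (j : ℕ) → V j →L[𝕂] (ℕ → B)} {M : ℕ}
    {w : ℕ → B} {n n' : (j : ℕ) → V j} {i l : ℕ} (hE : ∀ n, E i n 0 = n) (hi : i < l)
    (hn : ∀ j < i, n j = n' j) :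
    tailFamily E M w n l (M + i) = tailFamily E M w n' i (M + i) +
      ((M + i + 1).factorial : 𝕂)⁻¹ • (n i : B) := by
  obtain ⟨d, rfl⟩ := Nat.exists_eq_add_of_le (Nat.succ_le_of_lt hi)
  rw [tailFamily_stable n (by omega), tailFamily, tailFamily_congr hn, Pi.add_apply]
  congr 1
  have := shift_add (𝕂 := 𝕂) (M + i) 0 (E i (((M + i + 1).factorial : 𝕂)⁻¹ • n i))
  rw [add_zero] at this
  rw [this, hE]
  rfl

section Polynomial

variable {Y : Type*} [NormedAddCommGroup Y] [NormedSpace 𝕂 Y]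

theorem isPolyOp_shift {d M : ℕ} {v : Y → ℕ → B} (h : ∀ r, IsPolyOp 𝕂 d (fun x => v x r)) (r : ℕ) :
    IsPolyOp 𝕂 (if r < M then 0 else d) (fun x => shift 𝕂 M (v x) r) := by
  by_cases hr : r < M
  · simp only [shift_of_lt hr]; exact IsPolyOp.zero _
  · obtain ⟨s, rfl⟩ := Nat.exists_eq_add_of_le (not_lt.1 hr)
    simp only [shift_add, if_neg hr]; exact h s

theorem isPolyOp_seq {d : ℕ} {f : Y → B'} (hf : IsPolyOp 𝕂 d f) (A : B' →L[𝕂] (ℕ → B)) (r : ℕ) :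
    IsPolyOp 𝕂 d (fun x => A (f x) r) :=
  hf.continuousLinearMap_comp (ContinuousLinearMap.proj (R := 𝕂) (φ := fun _ : ℕ => B) r ∘L A)

/-- The bound pairs the order `r + 1` with the step `i`. Through `sum_min_sub_le` the coefficient of
order `2k + i + 1` of `G` has degree at most `i + 1`, and it only changes entries of index at least
`k + i`, where degree `i + 1` is allowed. -/
theorem isPolyOp_solFamily [CompleteSpace B] [CompleteSpace B'] (hG : AnalyticAt 𝕂 G 0)
    (q : ℕ → Y →L[𝕂] V) (i : ℕ) : ∀ r,
    IsPolyOp 𝕂 (min (r + 1 - k) i) (fun x => solFamily G k A E a₀ (fun j => q j x) i r) := by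
  induction i with
  | zero => exact fun r => IsPolyOp.const _ _
  | succ i ih =>
    intro r
    have h1 : IsPolyOp 𝕂 (i + 1) (fun x => -arcCoeff 𝕂 G
        (solFamily G k A E a₀ (fun j => q j x) i) (k + i + 1 + k)) := by
      refine (isPolyOp_arcCoeff hG ih fun c => ?_).continuousLinearMap_comp
        (-ContinuousLinearMap.id 𝕂 B')
      have h := sum_min_sub_le (k := k) (i := i) (b := c.blocksFun)
        (by rw [c.sum_blocksFun]; omega)
      refine (Finset.sum_le_sum fun j _ => ?_).trans h
      rw [Nat.sub_add_cancel (c.one_le_blocksFun j)]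
    have h2 := isPolyOp_shift (M := k + i) (isPolyOp_seq h1 A) r
    have h3 : IsPolyOp 𝕂 (i + 1) (fun x => ((k + i + 1).factorial : 𝕂)⁻¹ • q i x) :=
      isPolyOp_continuousLinearMap (by omega) (((k + i + 1).factorial : 𝕂)⁻¹ • q i)
    have h4 := isPolyOp_shift (M := k + i) (isPolyOp_seq h3 E) r
    have h5 : (if r < k + i then 0 else i + 1) ≤ min (r + 1 - k) (i + 1) := by
      split_ifs <;> omega
    exact (((ih r).mono (by omega)).add (h2.mono h5)).add (h4.mono h5)

/-- In the tail nothing is corrected any more, so its parameters enter linearly and the degree does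
not grow. -/
theorem isPolyOp_tailFamily {V : ℕ → Submodule 𝕂 B} {E : (j : ℕ) → V j →L[𝕂] (ℕ → B)} {M D : ℕ}
    (hD : 1 ≤ D) {w : Y → ℕ → B} (hw : ∀ r, IsPolyOp 𝕂 D (fun x => w x r))
    (n : (j : ℕ) → Y →L[𝕂] V j) (i : ℕ) : ∀ r,
    IsPolyOp 𝕂 D (fun x => tailFamily E M (w x) (fun j => n j x) i r) := by
  induction i with
  | zero => exact hw
  | succ i ih =>
    intro r
    have h3 : IsPolyOp 𝕂 D (fun x => ((M + i + 1).factorial : 𝕂)⁻¹ • n i x) :=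
      isPolyOp_continuousLinearMap hD (((M + i + 1).factorial : 𝕂)⁻¹ • n i)
    exact (ih r).add ((isPolyOp_shift (isPolyOp_seq h3 (E i)) r).mono (by split_ifs <;> omega))

end Polynomial

section Solutions

variable [CompleteSpace B']

theorem isSol_solFamily (hG : AnalyticAt 𝕂 G 0)
    (hA : ∀ y, A y ∈ chains 𝕂 G zbar k ∧ residual 𝕂 G zbar k (A y) = y)
    (hE : ∀ n, E n ∈ chains 𝕂 G zbar (k + 1)) (h₀ : IsSol 𝕂 G zbar (k + k) a₀) (q : ℕ → V) :
    ∀ i, IsSol 𝕂 G zbar (k + i + k) (solFamily G k A E a₀ q i)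
  | 0 => h₀
  | i + 1 => by
    have := (isSol_solFamily hG hA hE h₀ q i).extend hG hA (by omega)
    -- A chain of length `k + 1` placed at index `k + i` has no effect on orders up to `2k + i + 1`,
    -- so the new equation survives.
    exact this.add_shift hG (by omega) (hE _) le_rfl (by omega)

theorem isSol_tailFamily (hG : AnalyticAt 𝕂 G 0) {V : ℕ → Submodule 𝕂 B}
    {E : (j : ℕ) → V j →L[𝕂] (ℕ → B)} {M : ℕ} (hM : k ≤ M)
    (hE : ∀ j, ∀ n, E j n ∈ chains 𝕂 G zbar (k - j)) {w : ℕ → B}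
    (hw : IsSol 𝕂 G zbar (M + k) w) (n : (j : ℕ) → V j) :
    ∀ j ≤ k, IsSol 𝕂 G zbar (M + k) (tailFamily E M w n j)
  | 0, _ => hw
  | j + 1, hj => (isSol_tailFamily hG hM hE hw n j (by omega)).add_shift hG (by omega) (hE j _)
      (by omega) (by omega)

/-- Every solution of order `2k + l` arises from `solFamily` up to the coefficient `k + l`. -/
theorem exists_solFamily_eq (hG : AnalyticAt 𝕂 G 0)
    (hA : ∀ y, A y ∈ chains 𝕂 G zbar k ∧ residual 𝕂 G zbar k (A y) = y)
    (hE : ∀ n, E n ∈ chains 𝕂 G zbar (k + 1)) (hE0 : ∀ n, E n 0 = n)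
    (hV : ∀ v ∈ chains 𝕂 G zbar (k + 1), v 0 ∈ V)
    (h₀ : IsSol 𝕂 G zbar (k + k) a₀) {l : ℕ} {a : ℕ → B}
    (ha : IsSol 𝕂 G zbar (k + l + k) a) :
    ∀ i ≤ l, ∃ q : ℕ → V, ∀ r < k + i, solFamily G k A E a₀ q i r = a r
  | 0, _ => ⟨0, fun r hr => (h₀.1 r (by omega)).trans (ha.1 r (by omega)).symm⟩
  | i + 1, hi => by
    obtain ⟨q, hq⟩ := exists_solFamily_eq hG hA hE hE0 hV h₀ ha i (by omega)
    -- Step `i` is first carried out with parameter zero. The given solution and this one agree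
    -- below index `k + i`, so their difference is a chain of length `k + 1`, and its leading entry
    -- is the missing parameter.
    set q₀ : ℕ → V := Function.update q i 0 with hq₀
    have hqq : ∀ j < i, q j = q₀ j := fun j hj => by
      rw [hq₀, Function.update_of_ne (by omega)]
    have h1 : ∀ r < k + i, a r = solFamily G k A E a₀ q₀ (i + 1) r := fun r hr => by
      rw [solFamily_stable q₀ hr 1, ← solFamily_congr hqq, hq r hr]
    have h2 := (isSol_solFamily hG hA hE h₀ q₀ (i + 1)).sub_mem_chains (M := k + i) (s := k + 1)
      (ha.mono (by omega)) hG (by omega) h1 le_rfl (by omega)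
    have h3 := hV _ h2
    simp only [add_zero] at h3
    set u : V := ⟨_, h3⟩
    set q₁ : ℕ → V := Function.update q i (((k + i + 1).factorial : 𝕂) • u) with hq₁
    have hqq' : ∀ j < i, q₁ j = q₀ j := fun j hj => by
      rw [hq₁, Function.update_of_ne (by omega), hqq j hj]
    refine ⟨q₁, fun r hr => ?_⟩
    rcases Nat.lt_or_ge r (k + i) with h | h
    · rw [h1 r h, solFamily_stable _ h, solFamily_stable _ h, solFamily_congr hqq']
    · obtain rfl : r = k + i := by omega
      rw [solFamily_apply hE0 (Nat.lt_succ_self i) hqq' (by simp [hq₀])]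
      have : (q₁ i : B) = ((k + i + 1).factorial : 𝕂) • (u : B) := by simp [hq₁]
      rw [this, factorial_inv_smul_smul]
      exact add_sub_cancel _ _

/-- Every solution of order `M + k` arises from each solution `w` with the same first `M`
coefficients by `tailFamily`. -/
theorem exists_tailFamily_eq (hG : AnalyticAt 𝕂 G 0) {V : ℕ → Submodule 𝕂 B}
    {E : (j : ℕ) → V j →L[𝕂] (ℕ → B)} {M : ℕ} (hM : k ≤ M)
    (hE : ∀ j, ∀ n, E j n ∈ chains 𝕂 G zbar (k - j)) (hE0 : ∀ j n, E j n 0 = n)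
    (hV : ∀ j, ∀ v ∈ chains 𝕂 G zbar (k - j), v 0 ∈ V j) {w : ℕ → B}
    (hw : IsSol 𝕂 G zbar (M + k) w) {a : ℕ → B} (ha : IsSol 𝕂 G zbar (M + k) a)
    (haw : ∀ r < M, w r = a r) :
    ∀ i ≤ k, ∃ n : (j : ℕ) → V j, ∀ r < M + i, tailFamily E M w n i r = a r
  | 0, _ => ⟨0, haw⟩
  | i + 1, hi => by
    obtain ⟨n, hn⟩ := exists_tailFamily_eq hG hM hE hE0 hV hw ha haw i (by omega)
    -- Only orders up to `M + k` are prescribed, so a difference starting at index `M + i` is a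
    -- chain of length `k - i` only; hence the larger space `N_{k-i}`.
    have h2 := (isSol_tailFamily hG hM hE hw n i (by omega)).sub_mem_chains (M := M + i)
      (s := k - i) ha hG (by omega) (fun r hr => (hn r hr).symm) (by omega) (by omega)
    have h3 := hV i _ h2
    simp only [add_zero] at h3
    set u : V i := ⟨_, h3⟩
    set n₁ : (j : ℕ) → V j := Function.update n i (((M + i + 1).factorial : 𝕂) • u) with hn₁
    have hnn : ∀ j < i, n₁ j = n j := fun j hj => by
      rw [hn₁, Function.update_of_ne (by omega)]
    refine ⟨n₁, fun r hr => ?_⟩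
    rcases Nat.lt_or_ge r (M + i) with h | h
    · rw [tailFamily_stable _ h, tailFamily_congr hnn, hn r h]
    · obtain rfl : r = M + i := by omega
      rw [tailFamily_apply (hE0 i) (Nat.lt_succ_self i) hnn]
      have : (n₁ i : B) = ((M + i + 1).factorial : 𝕂) • (u : B) := by simp [hn₁]
      rw [this, factorial_inv_smul_smul]
      exact add_sub_cancel _ _

end Solutions

end Families

/-! ### The bijective parametrization. -/

section Parametrization

variable {𝕂 B B' : Type*} [RCLike 𝕂] [NormedAddCommGroup B] [NormedSpace 𝕂 B]
  [NormedAddCommGroup B'] [NormedSpace 𝕂 B'] {G : B → B'} {k : ℕ} {zbar : Fin k → B}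
  {A : B' →L[𝕂] (ℕ → B)} {W : ℕ → Submodule 𝕂 B} {E : W (k + 1) →L[𝕂] (ℕ → B)}
  {E' : (j : ℕ) → W (k - j) →L[𝕂] (ℕ → B)} {a₀ : ℕ → B}

/-- The operators `P_{i+1}` of the parametrization. -/
def headOp (G : B → B') (k : ℕ) (A : B' →L[𝕂] (ℕ → B)) (W : ℕ → Submodule 𝕂 B)
    (E : W (k + 1) →L[𝕂] (ℕ → B)) (a₀ : ℕ → B) (i : ℕ) (q : Fin i → W (k + 1)) : B :=
  -- Continuation by zero puts the parameter of step `i` to zero, so only the correction by `A` acts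
  -- in this step.
  ((k + i + 1).factorial : 𝕂) •
    solFamily G k A E a₀ (extendZero (V := fun _ => W (k + 1)) q) (i + 1) (k + i)

/-- The operators `P_{l+j+1}` of the parametrization. -/
def tailOp (G : B → B') (k : ℕ) (A : B' →L[𝕂] (ℕ → B)) (W : ℕ → Submodule 𝕂 B)
    (E : W (k + 1) →L[𝕂] (ℕ → B)) (E' : (j : ℕ) → W (k - j) →L[𝕂] (ℕ → B)) (a₀ : ℕ → B)
    (l : ℕ) (j : Fin k) (x : (Fin l → W (k + 1)) × ((i : Fin j) → W (k - i))) : B :=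
  ((k + l + j + 1).factorial : 𝕂) •
    tailFamily (V := fun i => W (k - i)) E' (k + l)
      (solFamily G k A E a₀ (extendZero (V := fun _ => W (k + 1)) x.1) l)
      (extendZero (V := fun i => W (k - i)) x.2) j (k + l + j)

theorem isPolyOp_headOp [CompleteSpace B] [CompleteSpace B'] (hG : AnalyticAt 𝕂 G 0) (i : ℕ) :
    IsPolyOp 𝕂 (i + 1) (headOp G k A W E a₀ i) := by
  have h := (isPolyOp_solFamily (A := A) (E := E) (a₀ := a₀) (k := k) hG
    (extendZeroL 𝕂 (fun _ => W (k + 1)) i) (i + 1) (k + i)).continuousLinearMap_comp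
    (((k + i + 1).factorial : 𝕂) • ContinuousLinearMap.id 𝕂 B)
  simp only [extendZeroL_apply] at h
  exact h.mono (by omega)

theorem isPolyOp_tailOp [CompleteSpace B] [CompleteSpace B'] (hG : AnalyticAt 𝕂 G 0) (l : ℕ)
    (j : Fin k) : IsPolyOp 𝕂 (l + j + 1) (tailOp G k A W E E' a₀ l j) := by
  have h1 := fun r => (isPolyOp_solFamily (A := A) (E := E) (a₀ := a₀) (k := k) hG
    (fun i => extendZeroL 𝕂 (fun _ => W (k + 1)) l i ∘L
      ContinuousLinearMap.fst 𝕂 _ ((i : Fin j) → W (k - i))) l r).mono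
      (show _ ≤ l + j + 1 by omega)
  have h2 := (isPolyOp_tailFamily (V := fun i => W (k - i)) (E := E') (M := k + l) (by omega) h1
    (fun i => extendZeroL 𝕂 (fun i => W (k - i)) j i ∘L
      ContinuousLinearMap.snd 𝕂 (Fin l → W (k + 1)) _) j (k + l + j)).continuousLinearMap_comp
    (((k + l + j + 1).factorial : 𝕂) • ContinuousLinearMap.id 𝕂 B)
  simp only [ContinuousLinearMap.comp_apply, extendZeroL_apply] at h2
  exact h2

theorem paramPoint_eq_denormalize (hE0 : ∀ n, E n 0 = n) (hE0' : ∀ j n, E' j n 0 = n)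
    (h₀ : ∀ i < k, a₀ i = normalize 𝕂 zbar i) {l : ℕ}
    (x : (Fin l → W (k + 1)) × ((j : Fin k) → W (k - j))) :
    paramPoint W zbar (headOp G k A W E a₀) (tailOp G k A W E E' a₀ l) x =
      denormalize 𝕂 (k + l + k) (tailFamily (V := fun i => W (k - i)) E' (k + l)
        (solFamily G k A E a₀ (extendZero (V := fun _ => W (k + 1)) x.1) l)
        (extendZero (V := fun i => W (k - i)) x.2) k) := by
  ext r
  refine Fin.addCases (fun r => Fin.addCases (fun i => ?_) (fun i => ?_) r) (fun j => ?_) r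
  · rw [paramPoint, Fin.append_right, denormalize]
    simp only [Fin.val_natAdd]
    rw [tailFamily_apply (V := fun i => W (k - i)) (hE0' j) j.2
      (n' := extendZero (V := fun i => W (k - i)) fun i : Fin j => x.2 (Fin.castLE j.2.le i))
      (fun i hi => by rw [extendZero_of_lt _ hi, extendZero_of_lt _ (hi.trans j.2)]; rfl),
      smul_add, factorial_smul_inv_smul, extendZero_of_lt _ j.2, tailOp]
  · rw [paramPoint, Fin.append_left, Fin.append_left, denormalize]
    simp only [Fin.val_castAdd]
    have h1 := tailFamily_stable (V := fun i => W (k - i)) (E := E') (M := k + l) (i := 0)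
      (w := solFamily G k A E a₀ (extendZero (V := fun _ => W (k + 1)) x.1) l)
      (extendZero (V := fun i => W (k - i)) x.2) (show (i : ℕ) < k + l + 0 by omega) k
    have h2 := solFamily_stable (G := G) (k := k) (A := A) (E := E) (a₀ := a₀) (i := 0)
      (extendZero (V := fun _ => W (k + 1)) x.1) (show (i : ℕ) < k + 0 by omega) l
    rw [zero_add] at h1 h2
    rw [h1, tailFamily, h2, solFamily, h₀ i i.2, factorial_smul_normalize]
  · rw [paramPoint, Fin.append_left, Fin.append_right, denormalize]
    simp only [Fin.val_castAdd, Fin.val_natAdd]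
    have h1 := tailFamily_stable (V := fun i => W (k - i)) (E := E') (M := k + l) (i := 0)
      (w := solFamily G k A E a₀ (extendZero (V := fun _ => W (k + 1)) x.1) l)
      (extendZero (V := fun i => W (k - i)) x.2) (show k + (i : ℕ) < k + l + 0 by omega) k
    rw [zero_add] at h1
    rw [h1, tailFamily, solFamily_apply hE0 i.2
      (q' := extendZero (V := fun _ => W (k + 1)) fun j : Fin i => x.1 (Fin.castLE i.2.le j))
      (fun j hj => by rw [extendZero_of_lt _ hj, extendZero_of_lt _ (hj.trans i.2)]; rfl)
      (extendZero_of_le _ le_rfl), smul_add, factorial_smul_inv_smul, extendZero_of_lt _ i.2,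
      headOp]

/-- The system is triangular: each entry determines its parameter once the earlier ones are known,
whatever the operators are. -/
theorem paramPoint_injective {l : ℕ} (P : (i : ℕ) → (Fin i → W (k + 1)) → B)
    (Q : (j : Fin k) → (Fin l → W (k + 1)) × ((i : Fin j) → W (k - i)) → B) :
    Function.Injective (paramPoint W zbar P Q) := by
  rintro ⟨q, n⟩ ⟨q', n'⟩ h
  have hq : ∀ i (hi : i < l), q ⟨i, hi⟩ = q' ⟨i, hi⟩ := by
    intro i
    induction i using Nat.strong_induction_on with
    | _ i ih =>
      intro hi
      have h1 := congrFun h (Fin.castAdd k (Fin.natAdd k ⟨i, hi⟩))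
      simp only [paramPoint, Fin.append_left, Fin.append_right] at h1
      have h2 : (fun j : Fin i => q (Fin.castLE hi.le j)) = fun j => q' (Fin.castLE hi.le j) :=
        funext fun j => ih j j.2 _
      rw [h2] at h1
      exact Subtype.ext (add_left_cancel h1)
  obtain rfl : q = q' := funext fun i => hq i i.2
  have hn : ∀ j (hj : j < k), n ⟨j, hj⟩ = n' ⟨j, hj⟩ := by
    intro j
    induction j using Nat.strong_induction_on with
    | _ j ih =>
      intro hj
      have h1 := congrFun h (Fin.natAdd (k + l) ⟨j, hj⟩)
      simp only [paramPoint, Fin.append_right] at h1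
      have h2 : (fun i : Fin j => n (Fin.castLE hj.le i)) = fun i => n' (Fin.castLE hj.le i) :=
        funext fun i => ih i i.2 _
      rw [h2] at h1
      exact Subtype.ext (add_left_cancel h1)
  obtain rfl : n = n' := funext fun j => hn j j.2
  rfl

theorem bijOn_paramPoint [CompleteSpace B'] (hG : AnalyticAt 𝕂 G 0) (hG0 : G 0 = 0)
    (hA : ∀ y, A y ∈ chains 𝕂 G zbar k ∧ residual 𝕂 G zbar k (A y) = y)
    (hE : ∀ n, E n ∈ chains 𝕂 G zbar (k + 1)) (hE0 : ∀ n, E n 0 = n)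
    (hW : ∀ v ∈ chains 𝕂 G zbar (k + 1), v 0 ∈ W (k + 1))
    (hE' : ∀ j, ∀ n, E' j n ∈ chains 𝕂 G zbar (k - j)) (hE0' : ∀ j n, E' j n 0 = n)
    (hW' : ∀ j, ∀ v ∈ chains 𝕂 G zbar (k - j), v 0 ∈ W (k - j))
    (h₀ : IsSol 𝕂 G zbar (k + k) a₀) (l : ℕ) :
    Set.BijOn (paramPoint W zbar (headOp G k A W E a₀) (tailOp G k A W E E' a₀ l)) Set.univ
      (XBar 𝕂 G zbar (k + l + k)) := by
  refine ⟨fun x _ => ?_, (paramPoint_injective _ _).injOn, fun z hz => ?_⟩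
  · rw [paramPoint_eq_denormalize hE0 hE0' h₀.1, denormalize_mem_XBar hG0 (by omega)]
    exact isSol_tailFamily (V := fun i => W (k - i)) hG (by omega) hE'
      (isSol_solFamily hG hA hE h₀ _ l) _ k le_rfl
  · have hz' := (normalize_isSol hG0 (by omega)).1 hz
    obtain ⟨q, hq⟩ := exists_solFamily_eq hG hA hE hE0 hW h₀ hz' l le_rfl
    obtain ⟨n, hn⟩ := exists_tailFamily_eq (V := fun i => W (k - i)) (M := k + l) hG (by omega) hE'
      hE0' hW' (isSol_solFamily hG hA hE h₀ q l) hz' hq k le_rfl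
    refine ⟨(fun i => q i, fun j => n j), Set.mem_univ _, ?_⟩
    rw [paramPoint_eq_denormalize hE0 hE0' h₀.1]
    ext r
    rw [solFamily_congr (q' := q) fun j hj => extendZero_of_lt _ hj,
      tailFamily_congr (V := fun i => W (k - i)) (n' := n) fun j hj => extendZero_of_lt _ hj,
      denormalize, hn r r.2, factorial_smul_normalize]

end Parametrization

/-! ### Consequences of regularity and of the minimality of `k`. -/

section Regular

variable {𝕂 B B' : Type*} [RCLike 𝕂] [NormedAddCommGroup B] [NormedSpace 𝕂 B]
  [NormedAddCommGroup B'] [NormedSpace 𝕂 B'] {G : B → B'} {k : ℕ}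
  {zbar : Fin k → B} {Nc : ℕ → Submodule 𝕂 B} {Rc : ℕ → Submodule 𝕂 B'}

/-- Otherwise `S_{k+1} = 0`, and the sum operator would be surjective without it. -/
theorem IsRegular.exists_mem_N_notMem (h : IsRegular 𝕂 G zbar Nc Rc) (hk : 1 ≤ k)
    (hmin : ¬ Function.Surjective (sumOp 𝕂 G zbar Rc (k - 1))) :
    ∃ n ∈ N 𝕂 G zbar Rc k, n ∉ N 𝕂 G zbar Rc (k + 1) := by
  by_contra! hN
  have h0 : ∀ n, S 𝕂 G zbar Rc k n = 0 := fun n => (mem_N_succ.1 (hN n n.2)).2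
  have h1 : LinearMap.range (S 𝕂 G zbar Rc k) = ⊥ := by
    rw [LinearMap.range_eq_bot]; exact LinearMap.ext h0
  have h2 := (Rsum_eq_top_iff_surjective k).2 h.surjective
  rw [Rsum_succ, h1, sup_bot_eq] at h2
  refine hmin ((Rsum_eq_top_iff_surjective (k - 1)).1 ?_)
  rw [Nat.sub_add_cancel hk]
  exact h2

variable [CompleteSpace B']

theorem trunc_image_eq (hG : AnalyticAt 𝕂 G 0) (hG0 : G 0 = 0) {A : B' →L[𝕂] (ℕ → B)}
    (hA : ∀ y, A y ∈ chains 𝕂 G zbar k ∧ residual 𝕂 G zbar k (A y) = y) {l : ℕ}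
    (h : k + l ≤ 2 * k + l) :
    trunc h '' XBar 𝕂 G zbar (2 * k + l) =
      truncInf (k + l) '' XBarInf 𝕂 G zbar := by
  ext w
  constructor
  · rintro ⟨z, hz, rfl⟩
    have hz' := (normalize_isSol hG0 (by omega)).1 hz
    obtain ⟨b, hb, hbz⟩ := (hz'.mono (by omega) : IsSol 𝕂 G zbar (k + l + k) _).exists_formal_solution
      hG hA (by omega)
    refine ⟨_, (mem_XBarInf_iff hG0 b).2 hb, funext fun i => ?_⟩
    rw [truncInf, hbz i i.2]
    exact factorial_smul_normalize z (Fin.castLE (by omega) i)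
  · rintro ⟨z, hz, rfl⟩
    set a : ℕ → B := fun i => ((i + 1).factorial : 𝕂)⁻¹ • z i with ha
    have hza : z = fun i => ((i + 1).factorial : 𝕂) • a i :=
      funext fun i => (factorial_smul_inv_smul _ _).symm
    rw [hza, mem_XBarInf_iff hG0] at hz
    refine ⟨denormalize 𝕂 (2 * k + l) a, (denormalize_mem_XBar hG0 (by omega)).2 (hz _),
      funext fun i => ?_⟩
    rw [hza]
    rfl

theorem trunc_image_ssubset (hG : AnalyticAt 𝕂 G 0) (hG0 : G 0 = 0) {l : ℕ} (hl : 1 ≤ l)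
    (hne : ∃ a, IsSol 𝕂 G zbar (2 * k + l) a) {E : N 𝕂 G zbar Rc k →L[𝕂] (ℕ → B)}
    (hE : ∀ n, E n ∈ chains 𝕂 G zbar k ∧ E n 0 = n)
    (hN : ∀ v ∈ chains 𝕂 G zbar (k + 1), v 0 ∈ N 𝕂 G zbar Rc (k + 1))
    (hn : ∃ n ∈ N 𝕂 G zbar Rc k, n ∉ N 𝕂 G zbar Rc (k + 1))
    (h₁ : k + l ≤ 2 * k + l) (h₂ : k + l ≤ 2 * k + l - 1) :
    trunc h₁ '' XBar 𝕂 G zbar (2 * k + l) ⊂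
      trunc h₂ '' XBar 𝕂 G zbar (2 * k + l - 1) := by
  refine ⟨?_, fun h => ?_⟩
  · rintro _ ⟨z, hz, rfl⟩
    have hz' := (normalize_isSol hG0 (by omega)).1 hz
    refine ⟨denormalize 𝕂 (2 * k + l - 1) (normalize 𝕂 z),
      (denormalize_mem_XBar hG0 (by omega)).2 (hz'.mono (by omega)), funext fun i => ?_⟩
    exact factorial_smul_normalize z (Fin.castLE (by omega) i)
  · obtain ⟨a, ha⟩ := hne
    obtain ⟨n, hnk, hnk'⟩ := hn
    obtain ⟨hv, hv0⟩ := hE ⟨n, hnk⟩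
    -- Moving the coefficient of order `k + l` by `n ∈ N_k` keeps the equations up to order `2k + l
    -- - 1`. If the result also extended to order `2k + l`, its difference from `a` would be a chain
    -- of length `k + 1` with leading entry `n`, so `n ∈ N_{k+1}`.
    have hb := (ha.mono (show 2 * k + l - 1 ≤ 2 * k + l by omega)).add_shift (M := k + l - 1) hG
      (by omega) hv (Nat.le_succ k) (by omega)
    obtain ⟨z, hz, hzb⟩ := h ⟨_, (denormalize_mem_XBar hG0 (by omega)).2 hb, rfl⟩
    have hz' := (normalize_isSol hG0 (by omega)).1 hz
    have hzr : ∀ r < k + l, normalize 𝕂 z r = (a + shift 𝕂 (k + l - 1) (E ⟨n, hnk⟩)) r := by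
      intro r hr
      rw [normalize_of_lt z (show r < 2 * k + l by omega), show z ⟨r, _⟩ = _ from
        congrFun hzb ⟨r, hr⟩]
      exact factorial_inv_smul_smul _ _
    have hd := hN _ (ha.sub_mem_chains (M := k + l - 1) (s := k + 1) hz' hG (by omega)
      (fun i hi => by rw [hzr i (by omega), Pi.add_apply, shift_of_lt hi, add_zero]) le_rfl
      (by omega))
    refine hnk' ?_
    have h0 := shift_add (𝕂 := 𝕂) (k + l - 1) 0 (E ⟨n, hnk⟩)
    simp only [add_zero] at hd h0
    rw [hzr _ (by omega), Pi.add_apply, add_sub_cancel_left, h0, hv0] at hd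
    exact hd

variable [CompleteSpace B]

theorem IsRegular.exists_rightInverse (h : IsRegular 𝕂 G zbar Nc Rc) :
    ∃ A : B' →L[𝕂] (ℕ → B),
      ∀ y, A y ∈ chains 𝕂 G zbar k ∧ residual 𝕂 G zbar k (A y) = y := by
  obtain ⟨A, hA⟩ := (stageData h.decomposition k (Nat.le_succ k)).exists_chain_residual
    h.decomposition le_rfl
  have htop := (Rsum_eq_top_iff_surjective k).2 h.surjective
  refine ⟨A ∘L (ContinuousLinearMap.id 𝕂 B').codRestrict _ fun y => ?_, fun y => hA _⟩
  rw [htop]; exact Submodule.mem_top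

theorem IsDecomposition.exists_chainOp (h : IsDecomposition 𝕂 G zbar Nc Rc) :
    ∃ E : (i : ℕ) → N 𝕂 G zbar Rc i →L[𝕂] (ℕ → B),
      ∀ i ≤ k + 1, ∀ n, E i n ∈ chains 𝕂 G zbar i ∧ E i n 0 = n := by
  have : ∀ i, ∃ E : N 𝕂 G zbar Rc i →L[𝕂] (ℕ → B),
      i ≤ k + 1 → ∀ n, E n ∈ chains 𝕂 G zbar i ∧ E n 0 = n := by
    intro i
    by_cases hi : i ≤ k + 1
    · obtain ⟨E, hE⟩ := (stageData h i hi).exists_chain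
      exact ⟨E, fun _ => hE⟩
    · exact ⟨0, fun hi' => absurd hi' hi⟩
  choose E hE using this
  exact ⟨E, hE⟩

theorem IsDecomposition.apply_zero_mem_N (h : IsDecomposition 𝕂 G zbar Nc Rc) {i : ℕ}
    (hi : i ≤ k + 1) {v : ℕ → B} (hv : v ∈ chains 𝕂 G zbar i) : v 0 ∈ N 𝕂 G zbar Rc i :=
  ((stageData h i hi).mem_N _).2 ⟨v, hv, rfl⟩

end Regular

end

end KRegular

/-! ### The main theorem. -/

open KRegular in
theorem corollary2 {𝕂 B B' : Type*} [RCLike 𝕂]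
    [NormedAddCommGroup B] [NormedSpace 𝕂 B] [CompleteSpace B]
    [NormedAddCommGroup B'] [NormedSpace 𝕂 B'] [CompleteSpace B']
    (G : B → B') (hG : AnalyticAt 𝕂 G 0) (hG0 : G 0 = 0)
    (k : ℕ) (hk : 1 ≤ k) (zbar : Fin k → B)
    (Nc : ℕ → Submodule 𝕂 B) (Rc : ℕ → Submodule 𝕂 B')
    (hreg : IsRegular 𝕂 G zbar Nc Rc)
    (hmin : ∀ j < k, ¬ Function.Surjective (sumOp 𝕂 G zbar Rc j)) :
    (∀ (l : ℕ) (hl : 1 ≤ l),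
      trunc (show k + l ≤ 2 * k + l by omega) '' XBar 𝕂 G zbar (2 * k + l) ⊂
          trunc (show k + l ≤ 2 * k + l - 1 by omega) '' XBar 𝕂 G zbar (2 * k + l - 1) ∧
        trunc (show k + l ≤ 2 * k + l by omega) '' XBar 𝕂 G zbar (2 * k + l) =
          truncInf (k + l) '' XBarInf 𝕂 G zbar) ∧
    (∀ l : ℕ, 1 ≤ l → ∀ z ∈ XBar 𝕂 G zbar (2 * k + l),
      ∃ γ : 𝕂 → B, AnalyticAt 𝕂 γ 0 ∧ γ 0 = 0 ∧ (∀ᶠ ε in 𝓝 (0 : 𝕂), G (γ ε) = 0) ∧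
        ∀ i : Fin (2 * k + l), (i : ℕ) < k + l → iteratedDeriv ((i : ℕ) + 1) γ 0 = z i) ∧
    (∃ P : (i : ℕ) → (Fin i → N 𝕂 G zbar Rc (k + 1)) → B,
      (∀ i, IsPolyOp 𝕂 (i + 1) (P i)) ∧
      (FiniteDimensional 𝕂 B → FiniteDimensional 𝕂 B' →
        ∀ i, IsPolyInCoordinates 𝕂 (i + 1) (P i)) ∧
      ∀ l : ℕ, 1 ≤ l →
        ∃ Q : (j : Fin k) →
            (Fin l → N 𝕂 G zbar Rc (k + 1)) × ((i : Fin j) → N 𝕂 G zbar Rc (k - i)) → B,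
          (∀ j : Fin k, IsPolyOp 𝕂 (l + j + 1) (Q j)) ∧
          (FiniteDimensional 𝕂 B → FiniteDimensional 𝕂 B' →
            ∀ j : Fin k, IsPolyInCoordinates 𝕂 (l + j + 1) (Q j)) ∧
          Set.BijOn (paramPoint (N 𝕂 G zbar Rc) zbar P Q) Set.univ
            (XBar 𝕂 G zbar (k + l + k))) := by
  obtain ⟨A, hA⟩ := hreg.exists_rightInverse
  obtain ⟨E, hE⟩ := hreg.decomposition.exists_chainOp
  obtain ⟨z₀, hz₀⟩ := hreg.leading
  have hN : ∀ i ≤ k + 1, ∀ v ∈ chains 𝕂 G zbar i, v 0 ∈ N 𝕂 G zbar Rc i :=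
    fun i hi v hv => hreg.decomposition.apply_zero_mem_N hi hv
  set a₀ : ℕ → B := normalize 𝕂 z₀
  have h₀ : IsSol 𝕂 G zbar (k + k) a₀ := ((normalize_isSol hG0 (by omega)).1 hz₀).mono (by omega)
  have hEk := hE (k + 1) le_rfl
  refine ⟨fun l hl => ⟨?_, trunc_image_eq hG hG0 hA _⟩, fun l hl z hz => ?_,
    headOp G k A (N 𝕂 G zbar Rc) (E (k + 1)) a₀, isPolyOp_headOp hG,
    fun _ _ i => (isPolyOp_headOp hG i).isPolyInCoordinates, fun l hl =>
    ⟨tailOp G k A (N 𝕂 G zbar Rc) (E (k + 1)) (fun j => E (k - j)) a₀ l, isPolyOp_tailOp hG l,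
      fun _ _ j => (isPolyOp_tailOp hG l j).isPolyInCoordinates, ?_⟩⟩
  -- A solution of order `2k + l` to start from is the family member with all parameters zero.
  · exact trunc_image_ssubset hG hG0 hl
      ⟨_, (isSol_solFamily hG hA (fun n => (hEk n).1) h₀ 0 l).mono (by omega)⟩
      (hE k (Nat.le_succ k)) (hN (k + 1) le_rfl)
      (hreg.exists_mem_N_notMem hk (hmin (k - 1) (by omega))) _ _
  · have hz' := (normalize_isSol hG0 (by omega)).1 hz
    obtain ⟨γ, h1, h2, h3, h4⟩ := exists_analytic_solution hG A hA (M := k + l) (by omega) hz'.1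
      fun m hm => hz'.2 m (by omega)
    refine ⟨γ, h1, h2, h3, fun i hi => ?_⟩
    rw [h4 i hi, factorial_smul_normalize]
  · exact bijOn_paramPoint hG hG0 hA (fun n => (hEk n).1) (fun n => (hEk n).2) (hN _ le_rfl)
      (fun j n => (hE (k - j) (by omega) n).1) (fun j n => (hE (k - j) (by omega) n).2)
      (fun j => hN (k - j) (by omega)) h₀ l
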